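/- Let $n\ge 1$ and let $(\mathcal C,\mathbb E,\mathfrak s)$ be an $n$-exangulated category in the sense of Herschend–Liu–Nakaoka: $\mathcal C$ is an additive category, $\mathbb E:\mathcal C^{op}\times\mathcal C\to \mathrm{Ab}$ is an additive bifunctor, and $\mathfrak s$ is an exact realization of $\mathbb E$ satisfying (EA1), (EA2) and (EA2)$^{op}$. A distinguished $n$-exangle is a complex with an extension $\rho\in\mathbb E(A_{n+1},A_0)$, $$\delta=(A_0\xrightarrow{\alpha_0}A_1\to\cdots\to A_n\xrightarrow{\alpha_n}A_{n+1}\overset{\rho}{\dashrightarrow}),$$ whose homotopy class is $\mathfrak s(\rho)$. These are the objects of a category $S(\mathcal C)$, in which a morphism $\delta\to\delta'$ is a chain map $\varphi=(\varphi_0,\dots,\varphi_{n+1})$ with $(\varphi_0)_*\rho=(\varphi_{n+1})^*\rho'$. An object $P$ is projective (an object $I$ is injective) if for every distinguished $n$-exangle as above every morphism $P\to A_{n+1}$ factors through $\alpha_n$ (every morphism $A_0\to I$ factors through $\alpha_0$). Let $\mathcal P$ and $\mathcal I$ be the full subcategories of projective and of injective objects. Assume that $\mathcal C$ has enough projectives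 and enough injectives, i.e. every object is the right end $A_{n+1}$ of a distinguished $n$-exangle with $A_1,\dots,A_n\in\mathcal P$, and the left end $A_0$ of a distinguished $n$-exangle with $A_1,\dots,A_n\in\mathcal I$. Let $\mathcal C/[\mathcal P]$ and $\mathcal C/[\mathcal I]$ be the quotients by the ideals of morphisms that factor through objects of $\mathcal P$, respectively $\mathcal I$. For an additive category $\mathcal D$ let $\mathrm{mod}\text{-}\mathcal D$ be the category of finitely presented right $\mathcal D$-modules, that is, of additive functors $F:\mathcal D^{op}\to \mathrm{Ab}$ with an exact sequence $\mathcal D(-,X)\to\mathcal D(-,Y)\to F\to0$, and let $\mathrm{proj}\text{-}\mathcal D$ and $\mathrm{inj}\text{-}\mathcal D$ be its full subcategories of projective and of injective objects. Below, $\mathrm{mod}\text{-}(\mathcal C/[\mathcal I])^{op}$ means $\mathrm{mod}\text{-}\mathcal D$ for $\mathcal D=(\mathcal C/[\mathcal I])^{op}$, and similarly for $\mathrm{proj}$ and $\mathrm{inj}$. For $\delta$ in $S(\mathcal C)$ put $$\delta^*=\mathrm{Coker}\bigl(\mathcal C(-,A_n)\xrightarrow{\mathcal C(-,\alpha_n)}\mathcal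 C(-,A_{n+1})\bigr),\qquad \delta_*=\mathrm{Coker}\bigl(\mathcal C(A_1,-)\xrightarrow{\mathcal C(\alpha_0,-)}\mathcal C(A_0,-)\bigr).$$ Then $\delta^*$ and $\delta_*$ are, naturally in $\delta$, objects of $\mathrm{mod}\text{-}(\mathcal C/[\mathcal P])$ and of $\mathrm{mod}\text{-}(\mathcal C/[\mathcal I])^{op}$; the functor $\delta\mapsto\delta^*$ from $S(\mathcal C)$ to $\mathrm{mod}\text{-}(\mathcal C/[\mathcal P])$ is full and essentially surjective; and there is a duality (an additive contravariant equivalence) $$\Phi:\mathrm{mod}\text{-}(\mathcal C/[\mathcal P])\to\mathrm{mod}\text{-}(\mathcal C/[\mathcal I])^{op},\qquad \delta^*\mapsto\delta_*,$$ that is, $\Phi(\delta^*)\cong\delta_*$ naturally in $\delta\in S(\mathcal C)$. Moreover, if $n$ is even, $\Phi$ restricts to dualities $$\mathrm{proj}\text{-}(\mathcal C/[\mathcal P])\to\mathrm{inj}\text{-}(\mathcal C/[\mathcal I])^{op},\qquad (\mathcal C/[\mathcal P])(-,A)\mapsto\mathbb E(A,-),$$ $$\mathrm{inj}\text{-}(\mathcal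 C/[\mathcal P])\to\mathrm{proj}\text{-}(\mathcal C/[\mathcal I])^{op},\qquad \mathbb E(-,A)\mapsto(\mathcal C/[\mathcal I])(A,-).$$ In particular, for every object $A$ of $\mathcal C$, the functor $(\mathcal C/[\mathcal P])(-,A)$ is in $\mathrm{proj}\text{-}(\mathcal C/[\mathcal P])$, $\mathbb E(-,A)$ is in $\mathrm{inj}\text{-}(\mathcal C/[\mathcal P])$, and the isomorphisms $\Phi((\mathcal C/[\mathcal P])(-,A))\cong\mathbb E(A,-)$ and $\Phi(\mathbb E(-,A))\cong(\mathcal C/[\mathcal I])(A,-)$ are natural in $A$. -/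

import Mathlib

open CategoryTheory CategoryTheory.Limits Opposite

universe v u

namespace NExang

/-! ### Ideal quotients and finitely presented modules -/

section Modules

/-- Two parallel morphisms are identified modulo the ideal `[P]` when their difference factors
through an object of the full subcategory `P`. -/
def idealRel {C : Type u} [Category.{v} C] [Preadditive C] (P : ObjectProperty C) : HomRel C :=
  fun X Y f g => ∃ (Z : C) (_ : P Z) (p : X ⟶ Z) (q : Z ⟶ Y), f - g = p ≫ q

/-- The full subcategory `P` contains the zero objects and is closed under finite direct sums
(so the morphisms factoring through `P` form an ideal). -/
class SumClosed {C : Type u} [Category.{v} C] [Preadditive C] [HasZeroObject C] [HasBinaryBiproducts C]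
    (P : ObjectProperty C) : Prop where
  zero : ∀ Z : C, IsZero Z → P Z
  biprod : ∀ X Y : C, P X → P Y → P (X ⊞ Y)

variable {C : Type u} [Category.{v} C] [Preadditive C] [HasZeroObject C] [HasBinaryBiproducts C]

theorem idealRel_add (P : ObjectProperty C) [SumClosed P] ⦃X Y : C⦄ (f₁ f₂ g₁ g₂ : X ⟶ Y)
    (hf : idealRel P f₁ f₂) (hg : idealRel P g₁ g₂) : idealRel P (f₁ + g₁) (f₂ + g₂) := by
  obtain ⟨Z, hZ, p, q, h⟩ := hf
  obtain ⟨Z', hZ', p', q', h'⟩ := hg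
  refine ⟨Z ⊞ Z', SumClosed.biprod _ _ hZ hZ', biprod.lift p p', biprod.desc q q', ?_⟩
  rw [biprod.lift_desc, ← h, ← h']
  abel

instance idealRel_congruence (P : ObjectProperty C) [SumClosed P] : Congruence (idealRel P) where
  equivalence := by
    intro X Y
    have hsymm : ∀ {f g : X ⟶ Y}, idealRel P f g → idealRel P g f := by
      rintro f g ⟨Z, hZ, p, q, h⟩
      exact ⟨Z, hZ, -p, q, by rw [Preadditive.neg_comp, ← h, neg_sub]⟩
    refine ⟨fun f => ?_, hsymm, fun {f g h} hfg hgh => ?_⟩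
    · obtain ⟨Z, hZ⟩ := HasZeroObject.zero (C := C)
      exact ⟨Z, SumClosed.zero _ hZ, 0, 0, by simp⟩
    · have := idealRel_add P _ _ _ _ hfg (hgh)
      obtain ⟨Z, hZ, p, q, e⟩ := this
      exact ⟨Z, hZ, p, q, by rw [← e]; abel⟩
  comp_left := by
    rintro X Y Y' a f g ⟨Z, hZ, p, q, h⟩
    exact ⟨Z, hZ, a ≫ p, q, by rw [Category.assoc, ← h, Preadditive.comp_sub]⟩
  comp_right := by
    rintro X Y Y' f g a ⟨Z, hZ, p, q, h⟩
    exact ⟨Z, hZ, p, q ≫ a, by rw [← Category.assoc, ← h, Preadditive.sub_comp]⟩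

/-- The ideal quotient `C/[P]`. -/
abbrev IdealQuotient (P : ObjectProperty C) : Type u := Quotient (idealRel P)

instance idealQuotientPreadditive (P : ObjectProperty C) [SumClosed P] :
    Preadditive (IdealQuotient P) :=
  Quotient.preadditive (idealRel P) (idealRel_add P)

/-- The canonical functor `C ⥤ C/[P]`. -/
abbrev toQuotient (P : ObjectProperty C) : C ⥤ IdealQuotient P := Quotient.functor (idealRel P)

variable (D : Type u) [Category.{v} D] [Preadditive D]

/-- A right `D`-module, i.e. an additive functor `Dᵒᵖ ⥤ Ab`, is finitely presented when there is
an exact sequence `D(-,X) ⟶ D(-,Y) ⟶ F ⟶ 0`. -/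
def isFinPres : ObjectProperty (Dᵒᵖ ⥤ AddCommGrpCat.{v}) := fun F =>
  F.Additive ∧
    ∃ (X Y : D) (f : X ⟶ Y) (p : preadditiveYoneda.obj Y ⟶ F), ∀ Z : Dᵒᵖ,
      Function.Exact ((preadditiveYoneda.map f).app Z) (p.app Z) ∧
        Function.Surjective (p.app Z)

/-- `mod-D`: the category of finitely presented right `D`-modules. -/
abbrev FPMod : Type (max u (v + 1)) := (isFinPres D).FullSubcategory

/-- `proj-D`: the projective objects of `mod-D`. -/
abbrev ProjMod : Type (max u (v + 1)) := (isProjective (FPMod D)).FullSubcategory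

/-- `inj-D`: the injective objects of `mod-D`. -/
abbrev InjMod : Type (max u (v + 1)) := (isInjective (FPMod D)).FullSubcategory

/-- A `C/[P]`-module, viewed as a contravariant functor on `C`.  This functor is fully faithful. -/
abbrev restrictRight (P : ObjectProperty C) [SumClosed P] :
    FPMod (IdealQuotient P) ⥤ (Cᵒᵖ ⥤ AddCommGrpCat.{v}) :=
  (isFinPres (IdealQuotient P)).ι ⋙
    (Functor.whiskeringLeft _ _ AddCommGrpCat.{v}).obj (toQuotient P).op

/-- A `(C/[P])ᵒᵖ`-module, viewed as a covariant functor on `C`.  This functor is fully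
faithful. -/
abbrev restrictLeft (P : ObjectProperty C) [SumClosed P] :
    FPMod (IdealQuotient P)ᵒᵖ ⥤ (C ⥤ AddCommGrpCat.{v}) :=
  (isFinPres (IdealQuotient P)ᵒᵖ).ι ⋙
    (Functor.whiskeringLeft _ _ AddCommGrpCat.{v}).obj (toQuotient P ⋙ opOp (IdealQuotient P))

end Modules

/-! ### Complexes of length `n + 2` with fixed ends -/

section Complexes

variable {C : Type u} [Category.{v} C] [Preadditive C]

/-- A complex `A = X₀ ⟶ X₁ ⟶ ⋯ ⟶ Xₙ ⟶ Xₙ₊₁ = B`, concentrated in degrees `0, …, n + 1`.  The two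
end terms are identified with `A` and `B` through isomorphisms (and not through equalities of
objects). -/
structure Cpx (n : ℕ) (A B : C) where
  K : CochainComplex C ℕ
  isZero : ∀ i, n + 1 < i → IsZero (K.X i)
  left : A ≅ K.X 0
  right : K.X (n + 1) ≅ B

namespace Cpx

variable {n : ℕ} {A B A' B' : C}

/-- The first differential `A ⟶ X₁`. -/
def first (X : Cpx n A B) : A ⟶ X.K.X 1 := X.left.hom ≫ X.K.d 0 1

/-- The last differential `Xₙ ⟶ B`. -/
def last (X : Cpx n A B) : X.K.X n ⟶ B := X.K.d n (n + 1) ≫ X.right.hom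

/-- The chain map `f` is of the form `(a, f₁, …, fₙ, b)`. -/
def HasEnds {X : Cpx n A B} {Y : Cpx n A' B'} (f : X.K ⟶ Y.K) (a : A ⟶ A') (b : B ⟶ B') : Prop :=
  X.left.hom ≫ f.f 0 = a ≫ Y.left.hom ∧ f.f (n + 1) ≫ Y.right.hom = X.right.hom ≫ b

/-- Homotopy equivalence of complexes with the same ends `A`, `B`: the homotopy equivalence and its
inverse are the identity at both ends. -/
def HomotopyEquivalent (X Y : Cpx n A B) : Prop :=
  ∃ (f : X.K ⟶ Y.K) (g : Y.K ⟶ X.K),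
    HasEnds (X := X) (Y := Y) f (𝟙 A) (𝟙 B) ∧ HasEnds (X := Y) (Y := X) g (𝟙 A) (𝟙 B) ∧
      Nonempty (Homotopy (f ≫ g) (𝟙 X.K)) ∧ Nonempty (Homotopy (g ≫ f) (𝟙 Y.K))

theorem HasEnds.id (X : Cpx n A B) : HasEnds (X := X) (Y := X) (𝟙 X.K) (𝟙 A) (𝟙 B) := by
  simp [HasEnds]

theorem HasEnds.comp {A'' B'' : C} {X : Cpx n A B} {Y : Cpx n A' B'} {Z : Cpx n A'' B''}
    {f : X.K ⟶ Y.K} {g : Y.K ⟶ Z.K} {a : A ⟶ A'} {b : B ⟶ B'} {a' : A' ⟶ A''} {b' : B' ⟶ B''}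
    (hf : HasEnds (X := X) (Y := Y) f a b) (hg : HasEnds (X := Y) (Y := Z) g a' b') :
    HasEnds (X := X) (Y := Z) (f ≫ g) (a ≫ a') (b ≫ b') := by
  refine ⟨?_, ?_⟩
  · rw [HomologicalComplex.comp_f, ← Category.assoc, hf.1, Category.assoc, hg.1, Category.assoc]
  · rw [HomologicalComplex.comp_f, Category.assoc, hg.2, ← Category.assoc, hf.2, Category.assoc]

theorem homotopyEquivalent_equivalence (n : ℕ) (A B : C) :
    _root_.Equivalence (HomotopyEquivalent (n := n) (A := A) (B := B)) where
  refl X := ⟨𝟙 _, 𝟙 _, HasEnds.id X, HasEnds.id X, ⟨Homotopy.ofEq (by simp)⟩,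
    ⟨Homotopy.ofEq (by simp)⟩⟩
  symm := fun ⟨f, g, hf, hg, h₁, h₂⟩ => ⟨g, f, hg, hf, h₂, h₁⟩
  trans := by
    rintro X Y Z ⟨f, g, hf, hg, ⟨h₁⟩, ⟨h₂⟩⟩ ⟨f', g', hf', hg', ⟨h₁'⟩, ⟨h₂'⟩⟩
    refine ⟨f ≫ f', g' ≫ g, by simpa using hf.comp hf', by simpa using hg'.comp hg, ⟨?_⟩, ⟨?_⟩⟩
    · refine (Homotopy.ofEq ?_).trans ((((h₁'.compLeft f).compRight g).trans
        (Homotopy.ofEq ?_)).trans h₁) <;> simp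
    · refine (Homotopy.ofEq ?_).trans ((((h₂.compLeft g').compRight f').trans
        (Homotopy.ofEq ?_)).trans h₂') <;> simp

/-- Homotopy equivalence as a setoid on the complexes with ends `A`, `B`. -/
def homotopySetoid (n : ℕ) (A B : C) : Setoid (Cpx n A B) :=
  ⟨HomotopyEquivalent, homotopyEquivalent_equivalence n A B⟩

/-- The homotopy equivalence classes `[X]` of complexes with ends `A`, `B`. -/
def HClass (n : ℕ) (A B : C) : Type (max u v) := _root_.Quotient (homotopySetoid n A B)

/-- The class `[X]`. -/
def cls (X : Cpx n A B) : HClass n A B := Quotient.mk (homotopySetoid n A B) X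

variable [HasZeroObject C] [HasBinaryBiproducts C]

/-- `M` is (isomorphic to, with the same ends `X₁` and `B'`) the mapping cone
`X₁ ⟶ X₂ ⊞ Y₁ ⟶ ⋯ ⟶ Xₙ₊₁ ⊞ Yₙ ⟶ Yₙ₊₁` of a chain map `f` which is the identity in degree `0`.  The
differentials are `[-d; f₁]`, `[-d, 0; fᵢ₊₁, d]` and `[fₙ₊₁, d]`. -/
def IsCone {X : Cpx n A B} {Y : Cpx n A B'} (f : X.K ⟶ Y.K) (M : Cpx n (X.K.X 1) B') : Prop :=
  ∃ e : ∀ i j : ℕ, i + 1 = j → 1 ≤ i → i ≤ n → (M.K.X i ≅ X.K.X j ⊞ Y.K.X i),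
    (∀ (h : 1 ≤ n), M.first ≫ (e 1 2 rfl le_rfl h).hom = biprod.lift (-X.K.d 1 2) (f.f 1)) ∧
    (∀ (i j k : ℕ) (hij : i + 1 = j) (hjk : j + 1 = k) (hi : 1 ≤ i) (hj : j ≤ n),
      M.K.d i j ≫ (e j k hjk (by omega) hj).hom =
        (e i j hij hi (by omega)).hom ≫
          biprod.desc (biprod.lift (-X.K.d j k) (f.f j)) (biprod.lift 0 (Y.K.d i j))) ∧
    (∀ (h : 1 ≤ n), M.last =
      (e n (n + 1) rfl h le_rfl).hom ≫ biprod.desc (f.f (n + 1) ≫ Y.right.hom) Y.last)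

/-- `N` is (isomorphic to, with the same ends `A` and `Yₙ`) the mapping cocone
`X₀ ⟶ X₁ ⊞ Y₀ ⟶ ⋯ ⟶ Xₙ ⊞ Yₙ₋₁ ⟶ Yₙ` of a chain map `f` which is the identity in degree `n + 1`:
the notion dual to the mapping cone.  The differentials are `[d; f₀]`, `[d, 0; fᵢ, -d]` and
`[fₙ, -d]`. -/
def IsCocone {X : Cpx n A B} {Y : Cpx n A' B} (f : X.K ⟶ Y.K) (N : Cpx n A (Y.K.X n)) : Prop :=
  ∃ e : ∀ i j : ℕ, i + 1 = j → j ≤ n → (N.K.X j ≅ X.K.X j ⊞ Y.K.X i),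
    (∀ (h : 1 ≤ n), N.first ≫ (e 0 1 rfl h).hom =
      biprod.lift X.first (X.left.hom ≫ f.f 0)) ∧
    (∀ (i j k : ℕ) (hij : i + 1 = j) (hjk : j + 1 = k) (hk : k ≤ n),
      N.K.d j k ≫ (e j k hjk hk).hom =
        (e i j hij (by omega)).hom ≫
          biprod.desc (biprod.lift (X.K.d j k) (f.f j)) (biprod.lift 0 (-Y.K.d i j))) ∧
    (∀ (i : ℕ) (hi : i + 1 = n), N.last =
      (e i n hi le_rfl).hom ≫ biprod.desc (f.f n) (-Y.K.d i n))

end Cpx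

end Complexes

/-! ### `n`-exangles and `n`-exangulated categories -/

section Exangulated

variable {C : Type u} [Category.{v} C] [Preadditive C]

/-- `a_* δ` for an extension `δ ∈ 𝔼(B, A)` and `a : A ⟶ A'`. -/
def push (E : Cᵒᵖ ⥤ C ⥤ AddCommGrpCat.{v}) {A A' B : C} (a : A ⟶ A') (δ : (E.obj (op B)).obj A) :
    (E.obj (op B)).obj A' :=
  (E.obj (op B)).map a δ

/-- `b^* δ` for an extension `δ ∈ 𝔼(B, A)` and `b : B' ⟶ B`. -/
def pull (E : Cᵒᵖ ⥤ C ⥤ AddCommGrpCat.{v}) {A B B' : C} (b : B' ⟶ B) (δ : (E.obj (op B)).obj A) :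
    (E.obj (op B')).obj A :=
  (E.map b.op).app A δ

/-- `⟨X, δ⟩` is an `n`-exangle: `δ` is attached to the complex `X`, and the sequences
`C(-,X₀) ⟶ ⋯ ⟶ C(-,Xₙ₊₁) ⟶ 𝔼(-,X₀)` and `C(Xₙ₊₁,-) ⟶ ⋯ ⟶ C(X₀,-) ⟶ 𝔼(Xₙ₊₁,-)` are exact. -/
structure IsExangle (E : Cᵒᵖ ⥤ C ⥤ AddCommGrpCat.{v}) {n : ℕ} {A B : C} (X : Cpx n A B)
    (δ : (E.obj (op B)).obj A) : Prop where
  push_first : push E X.first δ = 0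
  pull_last : pull E X.last δ = 0
  exact_right : ∀ (i : ℕ), i < n → ∀ (T : C) (g : T ⟶ X.K.X (i + 1)),
    g ≫ X.K.d (i + 1) (i + 2) = 0 → ∃ h : T ⟶ X.K.X i, h ≫ X.K.d i (i + 1) = g
  exact_right_end : ∀ (T : C) (g : T ⟶ B), pull E g δ = 0 → ∃ h : T ⟶ X.K.X n, h ≫ X.last = g
  exact_left : ∀ (i : ℕ), i < n → ∀ (T : C) (g : X.K.X (i + 1) ⟶ T),
    X.K.d i (i + 1) ≫ g = 0 → ∃ h : X.K.X (i + 2) ⟶ T, X.K.d (i + 1) (i + 2) ≫ h = g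
  exact_left_end : ∀ (T : C) (g : A ⟶ T), push E g δ = 0 → ∃ h : X.K.X 1 ⟶ T, X.first ≫ h = g

/-- A morphism is an inflation for `s` when it is the first differential of a conflation. -/
def IsInflation {E : Cᵒᵖ ⥤ C ⥤ AddCommGrpCat.{v}} {n : ℕ}
    (s : ∀ {A B : C}, (E.obj (op B)).obj A → Cpx.HClass n A B) {A A₁ : C} (f : A ⟶ A₁) : Prop :=
  ∃ (B : C) (δ : (E.obj (op B)).obj A) (X : Cpx n A B) (e : X.K.X 1 ≅ A₁),
    s δ = X.cls ∧ X.first ≫ e.hom = f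

/-- A morphism is a deflation for `s` when it is the last differential of a conflation. -/
def IsDeflation {E : Cᵒᵖ ⥤ C ⥤ AddCommGrpCat.{v}} {n : ℕ}
    (s : ∀ {A B : C}, (E.obj (op B)).obj A → Cpx.HClass n A B) {Bₙ B : C} (g : Bₙ ⟶ B) : Prop :=
  ∃ (A : C) (δ : (E.obj (op B)).obj A) (X : Cpx n A B) (e : Bₙ ≅ X.K.X n),
    s δ = X.cls ∧ e.hom ≫ X.last = g

/-- The structure of an `n`-exangulated category on an additive category `C`: an additive bifunctor
`𝔼 : Cᵒᵖ × C ⥤ Ab` with an exact realization `s`, subject to (EA1), (EA2) and (EA2)ᵒᵖ. -/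
structure NExangulated (C : Type u) [Category.{v} C] [Preadditive C] [HasZeroObject C] [HasBinaryBiproducts C]
    (n : ℕ) where
  E : Cᵒᵖ ⥤ C ⥤ AddCommGrpCat.{v}
  additive_left : E.Additive
  additive_right : ∀ B : Cᵒᵖ, (E.obj B).Additive
  /-- The correspondence sending an extension to a homotopy equivalence class. -/
  s : ∀ {A B : C}, (E.obj (op B)).obj A → Cpx.HClass n A B
  /-- (R0): morphisms of extensions lift. -/
  lift : ∀ {A B A' B' : C} (δ : (E.obj (op B)).obj A) (ρ : (E.obj (op B')).obj A')
    (X : Cpx n A B) (Y : Cpx n A' B'), s δ = X.cls → s ρ = Y.cls →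
    ∀ (a : A ⟶ A') (b : B ⟶ B'), push E a δ = pull E b ρ →
      ∃ f : X.K ⟶ Y.K, Cpx.HasEnds (X := X) (Y := Y) f a b
  /-- (R1): extensions are realized by `n`-exangles. -/
  exangle : ∀ {A B : C} (δ : (E.obj (op B)).obj A) (X : Cpx n A B), s δ = X.cls → IsExangle E X δ
  /-- (R2): `0 ∈ 𝔼(0, A)` is realized by `A = A ⟶ 0 ⟶ ⋯ ⟶ 0`. -/
  realize_zero : ∀ {A B : C} (X : Cpx n A B), IsZero B → IsIso (X.K.d 0 1) →
    (∀ i, 2 ≤ i → IsZero (X.K.X i)) → s (0 : (E.obj (op B)).obj A) = X.cls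
  /-- (R2), dual part: `0 ∈ 𝔼(B, 0)` is realized by `0 ⟶ ⋯ ⟶ 0 ⟶ B = B`. -/
  realize_zero_op : ∀ {A B : C} (X : Cpx n A B), IsZero A → IsIso (X.K.d n (n + 1)) →
    (∀ i, i < n → IsZero (X.K.X i)) → s (0 : (E.obj (op B)).obj A) = X.cls
  /-- (EA1) for inflations. -/
  inflation_comp : ∀ {A B D : C} (f : A ⟶ B) (g : B ⟶ D),
    IsInflation s f → IsInflation s g → IsInflation s (f ≫ g)
  /-- (EA1) for deflations. -/
  deflation_comp : ∀ {A B D : C} (f : A ⟶ B) (g : B ⟶ D),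
    IsDeflation s f → IsDeflation s g → IsDeflation s (f ≫ g)
  /-- (EA2): `(1, b)` has a good lift. -/
  good_lift : ∀ {A B D : C} (ρ : (E.obj (op D)).obj A) (b : B ⟶ D) (X : Cpx n A B) (Y : Cpx n A D),
    s (pull E b ρ) = X.cls → s ρ = Y.cls →
    ∃ f : X.K ⟶ Y.K, Cpx.HasEnds (X := X) (Y := Y) f (𝟙 A) b ∧
      ∃ M : Cpx n (X.K.X 1) D, Cpx.IsCone (X := X) (Y := Y) f M ∧ s (push E X.first ρ) = M.cls
  /-- (EA2)ᵒᵖ: `(a, 1)` has a good lift. -/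
  good_lift_op : ∀ {A D B : C} (ρ : (E.obj (op B)).obj A) (a : A ⟶ D) (X : Cpx n A B)
    (Y : Cpx n D B), s ρ = X.cls → s (push E a ρ) = Y.cls →
    ∃ f : X.K ⟶ Y.K, Cpx.HasEnds (X := X) (Y := Y) f a (𝟙 B) ∧
      ∃ N : Cpx n A (Y.K.X n), Cpx.IsCocone (X := X) (Y := Y) f N ∧ s (pull E Y.last ρ) = N.cls

namespace NExangulated

variable [HasZeroObject C] [HasBinaryBiproducts C] {n : ℕ} (T : NExangulated C n)

/-- The projective objects of an `n`-exangulated category. -/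
def proj : ObjectProperty C := fun P =>
  ∀ (A B : C) (δ : (T.E.obj (op B)).obj A) (X : Cpx n A B), T.s δ = X.cls →
    ∀ c : P ⟶ B, ∃ b : P ⟶ X.K.X n, b ≫ X.last = c

/-- The injective objects of an `n`-exangulated category. -/
def inj : ObjectProperty C := fun I =>
  ∀ (A B : C) (δ : (T.E.obj (op B)).obj A) (X : Cpx n A B), T.s δ = X.cls →
    ∀ c : A ⟶ I, ∃ b : X.K.X 1 ⟶ I, X.first ≫ b = c

instance : SumClosed T.proj where
  zero Z hZ A B δ X h c := ⟨0, hZ.eq_of_src _ _⟩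
  biprod P Q hP hQ A B δ X h c := by
    obtain ⟨b₁, h₁⟩ := hP A B δ X h (biprod.inl ≫ c)
    obtain ⟨b₂, h₂⟩ := hQ A B δ X h (biprod.inr ≫ c)
    exact ⟨biprod.desc b₁ b₂, by apply biprod.hom_ext' <;> simp [h₁, h₂]⟩

instance : SumClosed T.inj where
  zero Z hZ A B δ X h c := ⟨0, hZ.eq_of_tgt _ _⟩
  biprod P Q hP hQ A B δ X h c := by
    obtain ⟨b₁, h₁⟩ := hP A B δ X h (c ≫ biprod.fst)
    obtain ⟨b₂, h₂⟩ := hQ A B δ X h (c ≫ biprod.snd)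
    exact ⟨biprod.lift b₁ b₂, by apply biprod.hom_ext <;> simp [h₁, h₂]⟩

/-- Every object `B` is the right end of a distinguished `n`-exangle whose middle terms
`X₁, …, Xₙ` are projective. -/
def EnoughProjectives : Prop :=
  ∀ B : C, ∃ (A : C) (δ : (T.E.obj (op B)).obj A) (X : Cpx n A B), T.s δ = X.cls ∧
    ∀ i, 1 ≤ i → i ≤ n → T.proj (X.K.X i)

/-- Every object `A` is the left end of a distinguished `n`-exangle whose middle terms
`X₁, …, Xₙ` are injective. -/
def EnoughInjectives : Prop :=
  ∀ A : C, ∃ (B : C) (δ : (T.E.obj (op B)).obj A) (X : Cpx n A B), T.s δ = X.cls ∧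
    ∀ i, 1 ≤ i → i ≤ n → T.inj (X.K.X i)

/-- The distinguished `n`-exangles: the objects of `S(C)`. -/
structure Exangle where
  A : C
  B : C
  δ : (T.E.obj (op B)).obj A
  X : Cpx n A B
  distinguished : T.s δ = X.cls

variable {T}

/-- A morphism of distinguished `n`-exangles: a chain map whose end components `a`, `b` satisfy
`a_* δ = b^* δ'`. -/
@[ext]
structure Exangle.Hom (U V : Exangle T) where
  f : U.X.K ⟶ V.X.K
  a : U.A ⟶ V.A
  b : U.B ⟶ V.B
  ends : Cpx.HasEnds (X := U.X) (Y := V.X) f a b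
  comm : push T.E a U.δ = pull T.E b V.δ

/-- The category `S(C)` of distinguished `n`-exangles. -/
instance : Category (Exangle T) where
  Hom := Exangle.Hom
  id U := ⟨𝟙 _, 𝟙 _, 𝟙 _, Cpx.HasEnds.id _, by simp [push, pull]⟩
  comp {U V W} φ ψ := ⟨φ.f ≫ ψ.f, φ.a ≫ ψ.a, φ.b ≫ ψ.b, φ.ends.comp ψ.ends, by
    have h₁ := φ.comm
    have h₂ := ψ.comm
    simp only [push, pull] at h₁ h₂ ⊢
    rw [Functor.map_comp, ConcreteCategory.comp_apply, h₁, op_comp, Functor.map_comp,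
      NatTrans.comp_app, ConcreteCategory.comp_apply, ← h₂]
    exact (ConcreteCategory.congr_hom ((T.E.map φ.b.op).naturality ψ.a) V.δ).symm⟩
  id_comp _ := by ext1 <;> exact Category.id_comp _
  comp_id _ := by ext1 <;> exact Category.comp_id _
  assoc _ _ _ := by ext1 <;> exact Category.assoc _ _ _

theorem Exangle.Hom.last_comm {U V : Exangle T} (φ : U ⟶ V) :
    U.X.last ≫ φ.b = φ.f.f n ≫ V.X.last := by
  have h := φ.ends.2
  simp only [Cpx.last, Category.assoc, ← h]
  simp

theorem Exangle.Hom.first_comm {U V : Exangle T} (φ : U ⟶ V) :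
    φ.a ≫ V.X.first = U.X.first ≫ φ.f.f 1 := by
  have h := φ.ends.1
  simp only [Cpx.first, ← Category.assoc, ← h]
  simp

variable (T)

/-- The contravariant defect `δ ↦ δ^* = Coker (C(-,Xₙ) ⟶ C(-,Xₙ₊₁))`. -/
noncomputable def contraDefect : Exangle T ⥤ (Cᵒᵖ ⥤ AddCommGrpCat.{v}) where
  obj U := cokernel (preadditiveYoneda.map U.X.last)
  map {U V} φ := cokernel.map _ _ (preadditiveYoneda.map (φ.f.f n)) (preadditiveYoneda.map φ.b)
    (by rw [← Functor.map_comp, ← Functor.map_comp, Exangle.Hom.last_comm])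
  map_id U := by
    apply coequalizer.hom_ext
    have : Exangle.Hom.b (𝟙 U) = 𝟙 U.B := rfl
    simp [this]
  map_comp φ ψ := by
    apply coequalizer.hom_ext
    have : Exangle.Hom.b (φ ≫ ψ) = φ.b ≫ ψ.b := rfl
    simp [this]

/-- The covariant defect `δ ↦ δ_* = Coker (C(X₁,-) ⟶ C(X₀,-))`. -/
noncomputable def covDefect : (Exangle T)ᵒᵖ ⥤ (C ⥤ AddCommGrpCat.{v}) where
  obj U := cokernel (preadditiveCoyoneda.map U.unop.X.first.op)
  map {U V} φ := cokernel.map _ _ (preadditiveCoyoneda.map (φ.unop.f.f 1).op)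
    (preadditiveCoyoneda.map φ.unop.a.op)
    (by rw [← Functor.map_comp, ← Functor.map_comp, ← op_comp, ← op_comp,
      Exangle.Hom.first_comm])
  map_id U := by
    apply coequalizer.hom_ext
    have : Exangle.Hom.a (𝟙 U.unop) = 𝟙 U.unop.A := rfl
    simp [this]
  map_comp φ ψ := by
    apply coequalizer.hom_ext
    have : Exangle.Hom.a (ψ.unop ≫ φ.unop) = ψ.unop.a ≫ φ.unop.a := rfl
    simp [this]

end NExangulated

end Exangulated

end NExang

/-! Let `δ` be a distinguished exangle with extension `ρ ∈ 𝔼(B,A)`. Since `C(-,Xₙ) ⟶ C(-,B) ⟶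
𝔼(-,A)` is exact, the defect `δ^*` is the submodule of `𝔼(-,A)` generated by `ρ`; dually `δ_*` is
the submodule of `𝔼(B,-)` generated by the same `ρ`. A map out of a cyclic module is determined by
the image of the generator. For a morphism `φ : δ ⟶ δ'` with ends `a`, `b`, the map `δ^* ⟶ δ'^*`
sends `ρ` to `a_* ρ`, the map `δ'_* ⟶ δ_*` sends `ρ'` to `b^* ρ'`, and these are one and the same
element of `𝔼(B,A')`. Hence both defect functors identify the same morphisms of `S(C)`, and add them
in the same way.

Both functors are also full and essentially surjective, so both module categories are quotients of
`S(C)` by one relation, up to passing to the opposite (`exists_duality`). Fullness: a map `δ^* ⟶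
δ'^*` is represented by some `b` for which `b^* ρ'` dies on `Xₙ`; by exactness of `C(A,-) ⟶ 𝔼(B,-) ⟶
𝔼(Xₙ,-)` (`exists_push_eq`) it equals some `a_* ρ`, and `(a, b)` lifts to a chain map. Essential
surjectivity: given `l : X ⟶ Y`, the cone in (EA2), applied to an exangle ending in `Y` with
projective middle terms, has last map `X ⊞ P ⟶ Y` with `P` projective, which agrees with `l` modulo
projectives. The dual statements use `exists_pull_eq` and the cocone in (EA2)ᵒᵖ. `Generators` treats
both sides at once.

For an exangle with projective middle terms, `δ^*` is representable and `δ_*` is all of `𝔼(B,-)`;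
with injective middle terms, `δ^*` is all of `𝔼(-,A)` and `δ_*` is representable. This computes `Φ`
on these modules. Finally a duality exchanges projective and injective objects, and representables
are projective. -/

namespace NExang

/-! ### Objectwise surjections and cokernels in categories of functors to abelian groups. -/

section FunctorCategory

variable {J : Type*} [Category J]

/-- An epimorphism in an abelian category is the cokernel of its kernel, and here both the
epimorphism and the vanishing on the kernel are tested objectwise. -/
theorem exists_desc_of_surjective {P N Q : J ⥤ AddCommGrpCat.{v}} (p : P ⟶ N)
    (hp : ∀ j, Function.Surjective (p.app j)) (q : P ⟶ Q)
    (h : ∀ j (x : P.obj j), p.app j x = 0 → q.app j x = 0) : ∃ d : N ⟶ Q, p ≫ d = q := by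
  have : ∀ j, Epi (p.app j) := fun j => (AddCommGrpCat.epi_iff_surjective _).2 (hp j)
  have : Epi p := NatTrans.epi_of_epi_app p
  refine ⟨Abelian.epiDesc p q ?_, Abelian.comp_epiDesc _ _ _⟩
  ext j x
  apply h
  have := NatTrans.congr_app (kernel.condition p) j
  exact ConcreteCategory.congr_hom this x

theorem epi_of_surjective {P N : J ⥤ AddCommGrpCat.{v}} (p : P ⟶ N)
    (hp : ∀ j, Function.Surjective (p.app j)) : Epi p := by
  have : ∀ j, Epi (p.app j) := fun j => (AddCommGrpCat.epi_iff_surjective _).2 (hp j)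
  exact NatTrans.epi_of_epi_app p

theorem exists_iso_of_surjective {P N Q : J ⥤ AddCommGrpCat.{v}} (p : P ⟶ N) (q : P ⟶ Q)
    (hp : ∀ j, Function.Surjective (p.app j)) (hq : ∀ j, Function.Surjective (q.app j))
    (h : ∀ j (x : P.obj j), p.app j x = 0 ↔ q.app j x = 0) : ∃ e : N ≅ Q, p ≫ e.hom = q := by
  obtain ⟨d, hd⟩ := exists_desc_of_surjective p hp q fun j x => (h j x).1
  obtain ⟨d', hd'⟩ := exists_desc_of_surjective q hq p fun j x => (h j x).2
  have := epi_of_surjective p hp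
  have := epi_of_surjective q hq
  refine ⟨⟨d, d', ?_, ?_⟩, hd⟩
  · rw [← cancel_epi p, reassoc_of% hd, hd', Category.comp_id]
  · rw [← cancel_epi q, reassoc_of% hd', hd, Category.comp_id]

theorem cokernel_app_surjective {M N : J ⥤ AddCommGrpCat.{v}} (f : M ⟶ N) (j : J) :
    Function.Surjective ((cokernel.π f).app j) :=
  (AddCommGrpCat.epi_iff_surjective _).1 inferInstance

theorem cokernel_app_exact {M N : J ⥤ AddCommGrpCat.{v}} (f : M ⟶ N) (j : J) :
    Function.Exact (f.app j) ((cokernel.π f).app j) := by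
  have h := (ShortComplex.exact_cokernel f).map ((evaluation J AddCommGrpCat.{v}).obj j)
  exact (ShortComplex.ab_exact_iff_function_exact _).1 h

end FunctorCategory

/-! ### Cyclic submodules and the additive Yoneda lemma. -/

section Cyclic

variable {D : Type u} [Category.{v} D] [Preadditive D]

theorem additive_of_surjective {M N : Dᵒᵖ ⥤ AddCommGrpCat.{v}} (p : M ⟶ N) [M.Additive]
    (hp : ∀ j, Function.Surjective (p.app j)) : N.Additive where
  map_add {X Y f g} := by
    ext y
    obtain ⟨x, rfl⟩ := hp _ y
    have h : ∀ k : X ⟶ Y, N.map k (p.app X x) = p.app Y (M.map k x) := fun k =>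
      (ConcreteCategory.congr_hom (p.naturality k) x).symm
    rw [h, Functor.map_add]
    change p.app Y (M.map f x + M.map g x) = N.map f (p.app X x) + N.map g (p.app X x)
    rw [map_add, h, h]

/-- The additive Yoneda lemma: the morphism `D(-,B) ⟶ M` given by an element of `M(B)`. -/
def ofElement (M : Dᵒᵖ ⥤ AddCommGrpCat.{v}) [M.Additive] {B : D} (m : M.obj (op B)) :
    preadditiveYoneda.obj B ⟶ M where
  app T := AddCommGrpCat.ofHom
    { toFun := fun g : T.unop ⟶ B => M.map g.op m
      map_zero' := by
        change M.map (0 : T.unop ⟶ B).op m = 0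
        rw [op_zero, M.map_zero]; rfl
      map_add' := fun (g h : T.unop ⟶ B) => by
        change M.map (g + h).op m = M.map g.op m + M.map h.op m
        rw [op_add, M.map_add]; rfl }
  naturality X Y f := by
    ext (g : X.unop ⟶ B)
    exact ConcreteCategory.congr_hom (M.map_comp g.op f) m

theorem app_eq_map_app_id {M : Dᵒᵖ ⥤ AddCommGrpCat.{v}} {B : D}
    (p : preadditiveYoneda.obj B ⟶ M) {T : Dᵒᵖ} (g : T.unop ⟶ B) :
    p.app T g = M.map g.op (p.app (op B) (𝟙 B)) := by
  have h : p.app T (g ≫ 𝟙 B) = M.map g.op (p.app (op B) (𝟙 B)) :=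
    ConcreteCategory.congr_hom (p.naturality g.op) (𝟙 B)
  rwa [Category.comp_id] at h

theorem yoneda_hom_ext {M : Dᵒᵖ ⥤ AddCommGrpCat.{v}} {B : D}
    {p q : preadditiveYoneda.obj B ⟶ M}
    (h : p.app (op B) (𝟙 B) = q.app (op B) (𝟙 B)) : p = q := by
  ext T (g : T.unop ⟶ B)
  exact (app_eq_map_app_id p g).trans ((congrArg _ h).trans (app_eq_map_app_id q g).symm)

/-- The submodule of `M` generated by an element of `M(B)`. -/
noncomputable def cyclic (M : Dᵒᵖ ⥤ AddCommGrpCat.{v}) [M.Additive] {B : D} (m : M.obj (op B)) :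
    Dᵒᵖ ⥤ AddCommGrpCat.{v} := image (ofElement M m)

section

variable (M : Dᵒᵖ ⥤ AddCommGrpCat.{v}) [M.Additive] {B : D} (m : M.obj (op B))

/-- The inclusion of the generated submodule. -/
noncomputable def cyclicι : cyclic M m ⟶ M := image.ι _

/-- The representable functor mapping onto the generated submodule. -/
noncomputable def cyclicπ : preadditiveYoneda.obj B ⟶ cyclic M m := factorThruImage _

theorem cyclicπ_ι : cyclicπ M m ≫ cyclicι M m = ofElement M m := image.fac _

instance : Mono (cyclicι M m) := inferInstanceAs (Mono (image.ι _))

instance : Epi (cyclicπ M m) := inferInstanceAs (Epi (factorThruImage _))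

theorem cyclicπ_surjective (T : Dᵒᵖ) : Function.Surjective ((cyclicπ M m).app T) :=
  (AddCommGrpCat.epi_iff_surjective _).1 inferInstance

theorem cyclicι_injective (T : Dᵒᵖ) : Function.Injective ((cyclicι M m).app T) :=
  (AddCommGrpCat.mono_iff_injective _).1 inferInstance

theorem cyclicι_π {T : Dᵒᵖ} (g : T.unop ⟶ B) :
    (cyclicι M m).app T ((cyclicπ M m).app T g) = M.map g.op m :=
  ConcreteCategory.congr_hom (NatTrans.congr_app (cyclicπ_ι M m) T) g

theorem cyclicπ_eq_zero_iff {T : Dᵒᵖ} (g : T.unop ⟶ B) :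
    (cyclicπ M m).app T g = 0 ↔ M.map g.op m = 0 := by
  rw [← cyclicι_π]
  exact (map_eq_zero_iff _ (cyclicι_injective M m T)).symm

instance : (cyclic M m).Additive := additive_of_surjective _ (cyclicπ_surjective M m)

/-- The relations of a cyclic module are the annihilator of its generator, so it suffices that the
annihilator be the image of a representable functor. -/
theorem isFinPres_cyclic {X : D} (l : X ⟶ B)
    (hl : ∀ (T : D) (g : T ⟶ B), M.map g.op m = 0 ↔ ∃ h : T ⟶ X, h ≫ l = g) :
    isFinPres D (cyclic M m) := by
  refine ⟨inferInstance, X, B, l, cyclicπ M m, fun Z => ⟨fun g => ?_, cyclicπ_surjective M m Z⟩⟩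
  exact (cyclicπ_eq_zero_iff M m g).trans (hl Z.unop g)

end

/-- The hypothesis says that `α` carries the generator `m` into the submodule generated by `n`, so
`α` restricts to the submodules. -/
theorem exists_cyclic_map {M N : Dᵒᵖ ⥤ AddCommGrpCat.{v}} [M.Additive] [N.Additive] {B B' : D}
    (m : M.obj (op B)) (n : N.obj (op B')) (α : M ⟶ N) (b : B ⟶ B')
    (h : α.app _ m = N.map b.op n) :
    ∃ d : cyclic M m ⟶ cyclic N n, d ≫ cyclicι N n = cyclicι M m ≫ α := by
  have key : cyclicπ M m ≫ cyclicι M m ≫ α = preadditiveYoneda.map b ≫ ofElement N n := by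
    rw [← Category.assoc, cyclicπ_ι]
    apply yoneda_hom_ext
    change α.app _ (M.map (𝟙 _) m) = N.map (𝟙 B ≫ b).op n
    rw [M.map_id, Category.id_comp]
    exact h
  obtain ⟨d, hd⟩ := exists_desc_of_surjective (cyclicπ M m) (cyclicπ_surjective M m)
    (preadditiveYoneda.map b ≫ cyclicπ N n) (by
      intro T g hg
      apply cyclicι_injective N n T
      rw [map_zero]
      have := ConcreteCategory.congr_hom (NatTrans.congr_app key T) g
      rw [← cyclicπ_ι] at this
      refine this.symm.trans ?_
      change α.app T ((cyclicι M m).app T ((cyclicπ M m).app T g)) = 0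
      rw [hg, map_zero, map_zero])
  refine ⟨d, ?_⟩
  rw [← cancel_epi (cyclicπ M m), reassoc_of% hd, key, cyclicπ_ι]

end Cyclic

/-! ### The functor to finitely presented modules defined by a family of cyclic submodules. -/

section Generators

variable {D : Type u} [Category.{v} D] [Preadditive D] {S : Type*} [Category S]

/-- A family of modules `W U`, functorial in `U`, together with elements generating finitely
presented submodules, so that the morphisms between these submodules are induced by those of `S` and
every finitely presented module occurs. -/
structure Generators (W : S ⥤ Dᵒᵖ ⥤ AddCommGrpCat.{v}) where
  additive : ∀ U, (W.obj U).Additive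
  gen : S → D
  elt : ∀ U, (W.obj U).obj (op (gen U))
  compat : ∀ {U V : S} (φ : U ⟶ V), ∃ b : gen U ⟶ gen V,
    (W.map φ).app _ (elt U) = (W.obj V).map b.op (elt V)
  presented : ∀ U, ∃ (X : D) (l : X ⟶ gen U), ∀ (T : D) (g : T ⟶ gen U),
    (W.obj U).map g.op (elt U) = 0 ↔ ∃ h : T ⟶ X, h ≫ l = g
  full : ∀ {U V : S} (b : gen U ⟶ gen V),
    (∀ (T : D) (g : T ⟶ gen U), (W.obj U).map g.op (elt U) = 0 →
      (W.obj V).map (g ≫ b).op (elt V) = 0) →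
    ∃ φ : U ⟶ V, (W.map φ).app _ (elt U) = (W.obj V).map b.op (elt V)
  essSurj : ∀ {X Y : D} (l : X ⟶ Y), ∃ (U : S) (e : gen U ≅ Y), ∀ (T : D) (g : T ⟶ gen U),
    (W.obj U).map g.op (elt U) = 0 ↔ ∃ h : T ⟶ X, h ≫ l = g ≫ e.hom

namespace Generators

variable {W : S ⥤ Dᵒᵖ ⥤ AddCommGrpCat.{v}} (G : Generators W)

/-- The submodule generated by the chosen element. -/
noncomputable def submodule (U : S) : Dᵒᵖ ⥤ AddCommGrpCat.{v} :=
  haveI := G.additive U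
  cyclic (W.obj U) (G.elt U)

/-- The inclusion of the generated submodule. -/
noncomputable def incl (U : S) : G.submodule U ⟶ W.obj U :=
  haveI := G.additive U
  cyclicι (W.obj U) (G.elt U)

/-- The representable functor mapping onto the generated submodule. -/
noncomputable def proj (U : S) : preadditiveYoneda.obj (G.gen U) ⟶ G.submodule U :=
  haveI := G.additive U
  cyclicπ (W.obj U) (G.elt U)

instance (U : S) : Mono (G.incl U) :=
  haveI := G.additive U
  inferInstanceAs (Mono (cyclicι (W.obj U) (G.elt U)))

instance (U : S) : Epi (G.proj U) :=
  haveI := G.additive U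
  inferInstanceAs (Epi (cyclicπ (W.obj U) (G.elt U)))

theorem proj_surjective (U : S) (T : Dᵒᵖ) : Function.Surjective ((G.proj U).app T) :=
  haveI := G.additive U
  cyclicπ_surjective (W.obj U) (G.elt U) T

theorem incl_injective (U : S) (T : Dᵒᵖ) : Function.Injective ((G.incl U).app T) :=
  haveI := G.additive U
  cyclicι_injective (W.obj U) (G.elt U) T

theorem incl_proj (U : S) {T : Dᵒᵖ} (g : T.unop ⟶ G.gen U) :
    (G.incl U).app T ((G.proj U).app T g) = (W.obj U).map g.op (G.elt U) :=
  haveI := G.additive U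
  cyclicι_π (W.obj U) (G.elt U) g

theorem incl_proj_id (U : S) :
    (G.incl U).app _ ((G.proj U).app (op (G.gen U)) (𝟙 (G.gen U))) = G.elt U := by
  rw [incl_proj, op_id, (W.obj U).map_id]
  rfl

theorem proj_eq_zero_iff (U : S) {T : Dᵒᵖ} (g : T.unop ⟶ G.gen U) :
    (G.proj U).app T g = 0 ↔ (W.obj U).map g.op (G.elt U) = 0 :=
  haveI := G.additive U
  cyclicπ_eq_zero_iff (W.obj U) (G.elt U) g

theorem isFinPres (U : S) : isFinPres D (G.submodule U) := by
  have := G.additive U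
  obtain ⟨X, l, hl⟩ := G.presented U
  exact isFinPres_cyclic _ _ l hl

theorem exists_map {U V : S} (φ : U ⟶ V) :
    ∃ d : G.submodule U ⟶ G.submodule V, d ≫ G.incl V = G.incl U ≫ W.map φ := by
  have := G.additive U
  have := G.additive V
  obtain ⟨b, hb⟩ := G.compat φ
  exact exists_cyclic_map _ _ _ b hb

/-- The morphism induced on the generated submodules. -/
noncomputable def map {U V : S} (φ : U ⟶ V) : G.submodule U ⟶ G.submodule V := (G.exists_map φ).choose

theorem map_incl {U V : S} (φ : U ⟶ V) : G.map φ ≫ G.incl V = G.incl U ≫ W.map φ :=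
  (G.exists_map φ).choose_spec

/-- The functor sending `U` to the submodule of `W U` generated by the chosen element. -/
noncomputable def functor : S ⥤ FPMod D where
  obj U := ⟨G.submodule U, G.isFinPres U⟩
  map φ := ObjectProperty.homMk (G.map φ)
  map_id U := by
    apply ObjectProperty.hom_ext
    change G.map (𝟙 U) = 𝟙 _
    rw [← cancel_mono (G.incl U), map_incl]
    simp
  map_comp {U V X} φ ψ := by
    apply ObjectProperty.hom_ext
    change G.map (φ ≫ ψ) = G.map φ ≫ G.map ψ
    rw [← cancel_mono (G.incl X), map_incl, Category.assoc, map_incl, ← Category.assoc, map_incl,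
      Category.assoc, W.map_comp]

theorem hom_ext_elt {U : S} {N : Dᵒᵖ ⥤ AddCommGrpCat.{v}} {p q : G.submodule U ⟶ N}
    (h : p.app _ ((G.proj U).app (op (G.gen U)) (𝟙 (G.gen U))) =
      q.app _ ((G.proj U).app (op (G.gen U)) (𝟙 (G.gen U)))) : p = q := by
  rw [← cancel_epi (G.proj U)]
  exact yoneda_hom_ext h

theorem incl_map_proj_id {U V : S} (φ : U ⟶ V) :
    (G.incl V).app _ ((G.map φ).app _ ((G.proj U).app (op (G.gen U)) (𝟙 (G.gen U)))) =
      (W.map φ).app _ (G.elt U) := by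
  have := ConcreteCategory.congr_hom (NatTrans.congr_app (G.map_incl φ) (op (G.gen U)))
    ((G.proj U).app (op (G.gen U)) (𝟙 (G.gen U)))
  refine this.trans ?_
  change (W.map φ).app _ ((G.incl U).app _ _) = _
  rw [incl_proj_id]

theorem eq_of_incl {U V : S} {p q : G.submodule U ⟶ G.submodule V}
    (h : (G.incl V).app _ (p.app _ ((G.proj U).app (op (G.gen U)) (𝟙 (G.gen U)))) =
      (G.incl V).app _ (q.app _ ((G.proj U).app (op (G.gen U)) (𝟙 (G.gen U))))) : p = q :=
  G.hom_ext_elt (G.incl_injective _ _ h)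

/-- Equality of induced morphisms becomes an equality of elements of `W V`. For the two defects
these elements live in the same extension group, which is how the two functors are compared. -/
theorem map_eq_iff {U V : S} (φ ψ : U ⟶ V) :
    G.functor.map φ = G.functor.map ψ ↔
      (W.map φ).app _ (G.elt U) = (W.map ψ).app _ (G.elt U) := by
  rw [← incl_map_proj_id, ← incl_map_proj_id]
  refine ⟨fun h => ?_, fun h => ObjectProperty.hom_ext _ (G.eq_of_incl h)⟩
  have : G.map φ = G.map ψ := congrArg InducedCategory.Hom.hom h
  rw [this]

theorem map_add_eq_iff {U V : S} (φ ψ χ : U ⟶ V) :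
    G.functor.map φ + G.functor.map ψ = G.functor.map χ ↔
      (W.map φ).app _ (G.elt U) + (W.map ψ).app _ (G.elt U) = (W.map χ).app _ (G.elt U) := by
  rw [← incl_map_proj_id, ← incl_map_proj_id, ← incl_map_proj_id, ← map_add]
  refine ⟨fun h => ?_, fun h => ObjectProperty.hom_ext _ (G.eq_of_incl h)⟩
  have : G.map φ + G.map ψ = G.map χ := congrArg InducedCategory.Hom.hom h
  rw [← this]
  rfl

theorem proj_map {U V : S} (φ : U ⟶ V) (b : G.gen U ⟶ G.gen V)
    (h : (W.map φ).app _ (G.elt U) = (W.obj V).map b.op (G.elt V)) :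
    G.proj U ≫ G.map φ = preadditiveYoneda.map b ≫ G.proj V := by
  apply yoneda_hom_ext
  apply G.incl_injective V
  refine (G.incl_map_proj_id φ).trans (h.trans ?_)
  refine (G.incl_proj V b).symm.trans ?_
  change _ = (G.incl V).app _ ((G.proj V).app _ (𝟙 _ ≫ b))
  rw [Category.id_comp]

instance full_functor : G.functor.Full where
  map_surjective {U V} θ := by
    obtain ⟨b, hb⟩ := G.proj_surjective V _
      (θ.hom.app _ ((G.proj U).app (op (G.gen U)) (𝟙 (G.gen U))))
    change G.gen U ⟶ G.gen V at b
    have key : G.proj U ≫ θ.hom = preadditiveYoneda.map b ≫ G.proj V := by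
      apply yoneda_hom_ext
      refine hb.symm.trans ?_
      change _ = (G.proj V).app _ (𝟙 _ ≫ b)
      rw [Category.id_comp]
    -- `b` represents `θ` on the generators, so it carries the annihilator of one generator into
    -- that of the other; this is the compatibility that `G.full` asks for.
    obtain ⟨φ, hφ⟩ := G.full b (by
      intro T g hg
      rw [← G.proj_eq_zero_iff (T := op T)] at hg ⊢
      have := ConcreteCategory.congr_hom (NatTrans.congr_app key (op T)) g
      refine this.symm.trans ?_
      change θ.hom.app (op T) ((G.proj U).app (op T) g) = 0
      rw [hg]
      exact map_zero (θ.hom.app (op T)).hom)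
    refine ⟨φ, ObjectProperty.hom_ext _ ?_⟩
    exact (cancel_epi (G.proj U)).1 ((G.proj_map φ b hφ).trans key.symm)

instance essSurj_functor : G.functor.EssSurj where
  mem_essImage N := by
    obtain ⟨_, X, Y, l, p, hp⟩ := N.property
    obtain ⟨U, e, he⟩ := G.essSurj l
    obtain ⟨i, -⟩ := exists_iso_of_surjective (G.proj U) (preadditiveYoneda.map e.hom ≫ p)
      (G.proj_surjective U) (fun T x => by
        obtain ⟨y, rfl⟩ := (hp T).2 x
        let y' : T.unop ⟶ Y := y
        refine ⟨(y' ≫ e.inv : T.unop ⟶ _), ?_⟩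
        change p.app T ((y' ≫ e.inv) ≫ e.hom) = _
        rw [Category.assoc, e.inv_hom_id, Category.comp_id]) (fun T x => by
        exact (G.proj_eq_zero_iff U x).trans ((he _ x).trans ((hp T).1 _).symm))
    exact ⟨U, ⟨ObjectProperty.isoMk _ i⟩⟩

end Generators

end Generators

/-! ### Finitely presented modules: cokernels, epimorphisms, projectivity of representables. -/

section Representable

variable (D : Type u) [Category.{v} D] [Preadditive D]

theorem isFinPres_yoneda (Y : D) : isFinPres D (preadditiveYoneda.obj Y) := by
  refine ⟨inferInstance, Y, Y, 0, 𝟙 _, fun Z => ⟨fun g => ⟨fun h => ⟨(0 : Z.unop ⟶ Y), ?_⟩, ?_⟩,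
    Function.surjective_id⟩⟩
  · change (0 : Z.unop ⟶ Y) ≫ (0 : Y ⟶ Y) = g
    rw [comp_zero]
    exact h.symm
  · rintro ⟨h, rfl⟩
    change (show Z.unop ⟶ Y from h) ≫ (0 : Y ⟶ Y) = 0
    exact comp_zero

/-- The Yoneda embedding into the finitely presented modules. -/
def fpYoneda : D ⥤ FPMod D :=
  (isFinPres D).lift preadditiveYoneda (isFinPres_yoneda D)

variable {D} [HasBinaryBiproducts D]

/-- Keep the generators of `N`, and add to its relations `r` the images of the generators of `M`,
lifted along `p` to `s : Y' ⟶ Y`. This is where biproducts in `D` enter. -/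
theorem isFinPres_cokernel {M N : Dᵒᵖ ⥤ AddCommGrpCat.{v}} (f : M ⟶ N) (hM : isFinPres D M)
    (hN : isFinPres D N) : isFinPres D (cokernel f) := by
  obtain ⟨_, _, Y', _, p', hp'⟩ := hM
  obtain ⟨_, X, Y, r, p, hp⟩ := hN
  obtain ⟨s, hs⟩ := (hp (op Y')).2 (f.app _ (p'.app _ (𝟙 Y')))
  change Y' ⟶ Y at s
  have key : p' ≫ f = preadditiveYoneda.map s ≫ p := by
    apply yoneda_hom_ext
    refine hs.symm.trans ?_
    change p.app (op Y') s = p.app (op Y') (𝟙 Y' ≫ s)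
    rw [Category.id_comp]
  have key' : ∀ (Z : Dᵒᵖ) (h : Z.unop ⟶ Y'), f.app Z (p'.app Z h) = p.app Z (h ≫ s) :=
    fun Z h => ConcreteCategory.congr_hom (NatTrans.congr_app key Z) h
  refine ⟨additive_of_surjective (cokernel.π f) (cokernel_app_surjective f), X ⊞ Y', Y,
    biprod.desc r s, p ≫ cokernel.π f, fun Z => ⟨fun (g : Z.unop ⟶ Y) => ?_, ?_⟩⟩
  · change (cokernel.π f).app Z (p.app Z g) = 0 ↔ _
    rw [cokernel_app_exact f Z]
    constructor
    · rintro ⟨x, hx⟩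
      obtain ⟨h, rfl⟩ := (hp' Z).2 x
      change Z.unop ⟶ Y' at h
      have h0 : p.app Z (show Z.unop ⟶ Y from g - h ≫ s) = 0 := by
        have := map_sub (p.app Z).hom g (h ≫ s)
        refine this.trans (sub_eq_zero.2 ?_)
        exact hx.symm.trans (key' Z h)
      obtain ⟨k, hk⟩ := ((hp Z).1 _).1 h0
      change Z.unop ⟶ X at k
      change k ≫ r = g - h ≫ s at hk
      refine ⟨biprod.lift k h, ?_⟩
      change biprod.lift k h ≫ biprod.desc r s = g
      rw [biprod.lift_desc, hk, sub_add_cancel]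
    · rintro ⟨k, hk⟩
      change Z.unop ⟶ X ⊞ Y' at k
      change k ≫ biprod.desc r s = g at hk
      refine ⟨p'.app Z (k ≫ biprod.snd), ?_⟩
      rw [key']
      have h0 : p.app Z ((k ≫ biprod.fst) ≫ r) = 0 := ((hp Z).1 _).2 ⟨k ≫ biprod.fst, rfl⟩
      have h1 : g = (k ≫ biprod.fst) ≫ r + (k ≫ biprod.snd) ≫ s := by
        rw [← hk, biprod.desc_eq]
        simp
      rw [h1]
      refine Eq.trans ?_ (map_add (p.app Z).hom ((k ≫ biprod.fst) ≫ r)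
        ((k ≫ biprod.snd) ≫ s)).symm
      refine (zero_add _).symm.trans ?_
      exact congrArg (· + _) h0.symm
  · exact (cokernel_app_surjective f Z).comp (hp Z).2

/-- The cokernel taken among all functors is again finitely presented, so an epimorphism of `FPMod
D` already has zero cokernel objectwise. -/
theorem surjective_of_epi {M N : FPMod D} (f : M ⟶ N) [Epi f] (T : Dᵒᵖ) :
    Function.Surjective (f.hom.app T) := by
  let c : FPMod D := ⟨cokernel f.hom, isFinPres_cokernel f.hom M.property N.property⟩
  let q : N ⟶ c := ObjectProperty.homMk (cokernel.π f.hom)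
  have hq : q = 0 := by
    rw [← cancel_epi f]
    apply ObjectProperty.hom_ext
    change f.hom ≫ cokernel.π f.hom = f.hom ≫ 0
    rw [cokernel.condition, comp_zero]
  have hq' : cokernel.π f.hom = 0 := congrArg InducedCategory.Hom.hom hq
  intro x
  apply (cokernel_app_exact f.hom T x).1
  rw [hq']
  rfl

instance projective_fpYoneda (Y : D) : Projective ((fpYoneda D).obj Y) where
  factors {E X} f e _ := by
    have := E.property.1
    obtain ⟨x, hx⟩ := surjective_of_epi e (op Y) (f.hom.app (op Y) (𝟙 Y))
    refine ⟨ObjectProperty.homMk (ofElement E.obj x), ObjectProperty.hom_ext _ ?_⟩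
    apply yoneda_hom_ext
    change e.hom.app _ (E.obj.map (𝟙 Y).op x) = f.hom.app (op Y) (𝟙 Y)
    rw [op_id, E.obj.map_id]
    exact hx

end Representable


/-! ### Calculus of extensions and the exact sequences at the `𝔼`-terms. -/

section Extensions

variable {C : Type u} [Category.{v} C] (E : Cᵒᵖ ⥤ C ⥤ AddCommGrpCat.{v})

theorem push_id {A B : C} (δ : (E.obj (op B)).obj A) : push E (𝟙 A) δ = δ := by
  simp [push]

theorem pull_id {A B : C} (δ : (E.obj (op B)).obj A) : pull E (𝟙 B) δ = δ := by
  simp [pull]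

theorem push_comp {A A' A'' B : C} (a : A ⟶ A') (a' : A' ⟶ A'') (δ : (E.obj (op B)).obj A) :
    push E (a ≫ a') δ = push E a' (push E a δ) := by
  simp [push]

theorem pull_comp {A B B' B'' : C} (b : B' ⟶ B) (b' : B'' ⟶ B') (δ : (E.obj (op B)).obj A) :
    pull E (b' ≫ b) δ = pull E b' (pull E b δ) := by
  simp [pull]

theorem push_pull {A A' B B' : C} (a : A ⟶ A') (b : B' ⟶ B) (δ : (E.obj (op B)).obj A) :
    push E a (pull E b δ) = pull E b (push E a δ) :=
  (ConcreteCategory.congr_hom ((E.map b.op).naturality a) δ).symm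

theorem push_add {A A' B : C} (a : A ⟶ A') (δ ρ : (E.obj (op B)).obj A) :
    push E a (δ + ρ) = push E a δ + push E a ρ := map_add _ _ _

theorem pull_add {A B B' : C} (b : B' ⟶ B) (δ ρ : (E.obj (op B)).obj A) :
    pull E b (δ + ρ) = pull E b δ + pull E b ρ := map_add _ _ _

theorem push_zero {A A' B : C} (a : A ⟶ A') : push E a (0 : (E.obj (op B)).obj A) = 0 :=
  map_zero _

theorem pull_zero {A B B' : C} (b : B' ⟶ B) : pull E b (0 : (E.obj (op B)).obj A) = 0 :=
  map_zero _

end Extensions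

namespace NExangulated

variable {C : Type u} [Category.{v} C] [Preadditive C] [HasZeroObject C] [HasBinaryBiproducts C]
  {n : ℕ} (T : NExangulated C n)

theorem add_push {A A' B : C} (a a' : A ⟶ A') (δ : (T.E.obj (op B)).obj A) :
    push T.E (a + a') δ = push T.E a δ + push T.E a' δ := by
  have := T.additive_right (op B)
  simp only [push, Functor.map_add]
  rfl

theorem add_pull {A B B' : C} (b b' : B' ⟶ B) (δ : (T.E.obj (op B)).obj A) :
    pull T.E (b + b') δ = pull T.E b δ + pull T.E b' δ := by
  have := T.additive_left
  simp only [pull, op_add, Functor.map_add]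
  rfl

theorem zero_push {A A' B : C} (δ : (T.E.obj (op B)).obj A) :
    push T.E (0 : A ⟶ A') δ = 0 := by
  simpa using T.add_push (0 : A ⟶ A') 0 δ

theorem zero_pull {A B B' : C} (δ : (T.E.obj (op B)).obj A) :
    pull T.E (0 : B' ⟶ B) δ = 0 := by
  simpa using T.add_pull (0 : B' ⟶ B) 0 δ

theorem push_sub_eq_zero_iff {A A' B : C} (a a' : A ⟶ A') (δ : (T.E.obj (op B)).obj A) :
    push T.E (a - a') δ = 0 ↔ push T.E a δ = push T.E a' δ := by
  have := T.add_push (a - a') a' δ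
  rw [sub_add_cancel] at this
  rw [this, add_eq_right]

theorem pull_sub_eq_zero_iff {A B B' : C} (b b' : B' ⟶ B) (δ : (T.E.obj (op B)).obj A) :
    pull T.E (b - b') δ = 0 ↔ pull T.E b δ = pull T.E b' δ := by
  have := T.add_pull (b - b') b' δ
  rw [sub_add_cancel] at this
  rw [this, add_eq_right]

theorem exists_realization {A B : C} (δ : (T.E.obj (op B)).obj A) :
    ∃ X : Cpx n A B, T.s δ = X.cls := by
  obtain ⟨X, hX⟩ := _root_.Quotient.exists_rep (T.s δ)
  exact ⟨X, hX.symm⟩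

variable {T}

theorem pull_eq_zero_iff {A B D : C} {δ : (T.E.obj (op B)).obj A} {X : Cpx n A B}
    (h : T.s δ = X.cls) (g : D ⟶ B) :
    pull T.E g δ = 0 ↔ ∃ k : D ⟶ X.K.X n, k ≫ X.last = g := by
  refine ⟨(T.exangle δ X h).exact_right_end D g, ?_⟩
  rintro ⟨k, rfl⟩
  rw [pull_comp, (T.exangle δ X h).pull_last, pull_zero]

theorem push_eq_zero_iff {A B D : C} {δ : (T.E.obj (op B)).obj A} {X : Cpx n A B}
    (h : T.s δ = X.cls) (g : A ⟶ D) :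
    push T.E g δ = 0 ↔ ∃ k : X.K.X 1 ⟶ D, X.first ≫ k = g := by
  refine ⟨(T.exangle δ X h).exact_left_end D g, ?_⟩
  rintro ⟨k, rfl⟩
  rw [push_comp, (T.exangle δ X h).push_first, push_zero]

/-- A deflation onto `B` together with an arbitrary morphism to `B` gives a deflation, up to the
choice of the middle term. -/
theorem exists_desc_last (hn : 0 < n) {A B D : C} {ρ : (T.E.obj (op D)).obj A} {Y : Cpx n A D}
    (hY : T.s ρ = Y.cls) {X : Cpx n A B} (b : B ⟶ D) (hX : T.s (pull T.E b ρ) = X.cls) :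
    ∃ M : Cpx n (X.K.X 1) D, T.s (push T.E X.first ρ) = M.cls ∧
      ∃ e : M.K.X n ≅ B ⊞ Y.K.X n, M.last = e.hom ≫ biprod.desc b Y.last := by
  obtain ⟨f, hf, M, ⟨e, -, -, he⟩, hM⟩ := T.good_lift ρ b X Y hX hY
  refine ⟨M, hM, e n (n + 1) rfl hn le_rfl ≪≫ biprod.mapIso X.right (Iso.refl _), ?_⟩
  rw [he hn, Iso.trans_hom, Category.assoc]
  congr 1
  apply biprod.hom_ext' <;> simp [hf.2]

theorem exists_lift_first (hn : 0 < n) {A B D : C} {ρ : (T.E.obj (op B)).obj A} {X : Cpx n A B}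
    (hX : T.s ρ = X.cls) {Y : Cpx n D B} (a : A ⟶ D) (hY : T.s (push T.E a ρ) = Y.cls) :
    ∃ N : Cpx n A (Y.K.X n), T.s (pull T.E Y.last ρ) = N.cls ∧
      ∃ e : N.K.X 1 ≅ X.K.X 1 ⊞ D, N.first ≫ e.hom = biprod.lift X.first a := by
  obtain ⟨f, hf, N, ⟨e, he, -, -⟩, hN⟩ := T.good_lift_op ρ a X Y hX hY
  refine ⟨N, hN, e 0 1 rfl hn ≪≫ biprod.mapIso (Iso.refl _) Y.left.symm, ?_⟩
  rw [Iso.trans_hom, reassoc_of% (he hn)]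
  apply biprod.hom_ext <;> simp [hf.1]

/-- Exactness of `C(-,B) ⟶ 𝔼(-,A) ⟶ 𝔼(-,X₁)`. -/
theorem exists_pull_eq (hn : 0 < n) {A B D : C} {ρ : (T.E.obj (op B)).obj A} {Y : Cpx n A B}
    (hY : T.s ρ = Y.cls) (θ : (T.E.obj (op D)).obj A) (hθ : push T.E Y.first θ = 0) :
    ∃ c : D ⟶ B, pull T.E c ρ = θ := by
  -- `σ` has components `ρ` and `θ`, both killed by `Y.first`. The cone for `biprod.inl` therefore
  -- realizes the zero extension, its last map is a split epimorphism, and `biprod.inr` factors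
  -- through it; the component of this factorization in `B` is `c`.
  let σ : (T.E.obj (op (B ⊞ D))).obj A := pull T.E biprod.fst ρ + pull T.E biprod.snd θ
  obtain ⟨V, hV⟩ := T.exists_realization σ
  have hσ : pull T.E biprod.inl σ = ρ := by
    simp only [σ]
    rw [pull_add, ← pull_comp, ← pull_comp, biprod.inl_fst, biprod.inl_snd, pull_id, T.zero_pull,
      add_zero]
  obtain ⟨M, hM, e, he⟩ := T.exists_desc_last hn hV biprod.inl (hσ.symm ▸ hY)
  have hzero : push T.E Y.first σ = 0 := by
    simp only [σ]
    rw [push_add, push_pull, push_pull, hθ, (T.exangle ρ Y hY).push_first, pull_zero, pull_zero,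
      add_zero]
  obtain ⟨k, hk⟩ := (pull_eq_zero_iff hM biprod.inr).1 (by rw [hzero, pull_zero])
  let c : D ⟶ B := k ≫ e.hom ≫ biprod.fst
  have h1 : c ≫ biprod.inl + (k ≫ e.hom ≫ biprod.snd) ≫ V.last = biprod.inr := by
    rw [← hk, he, biprod.desc_eq]
    simp [c]
  -- The difference factors through `V.last`, hence annihilates `σ`; in components this reads `θ =
  -- c^* ρ`.
  have h2 : pull T.E (biprod.inr - c ≫ biprod.inl) σ = 0 :=
    (pull_eq_zero_iff hV _).2 ⟨k ≫ e.hom ≫ biprod.snd, by rw [← h1]; abel⟩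
  refine ⟨c, ?_⟩
  rw [T.pull_sub_eq_zero_iff, pull_comp, hσ] at h2
  rw [← h2]
  simp only [σ]
  rw [pull_add, ← pull_comp, ← pull_comp, biprod.inr_fst, biprod.inr_snd, pull_id, T.zero_pull,
    zero_add]

/-- Exactness of `C(A,-) ⟶ 𝔼(B,-) ⟶ 𝔼(Xₙ,-)`. -/
theorem exists_push_eq (hn : 0 < n) {A B D : C} {ρ : (T.E.obj (op B)).obj A} {X : Cpx n A B}
    (hX : T.s ρ = X.cls) (θ : (T.E.obj (op B)).obj D) (hθ : pull T.E X.last θ = 0) :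
    ∃ c : A ⟶ D, push T.E c ρ = θ := by
  let σ : (T.E.obj (op B)).obj (A ⊞ D) := push T.E biprod.inl ρ + push T.E biprod.inr θ
  obtain ⟨V, hV⟩ := T.exists_realization σ
  have hσ : push T.E biprod.fst σ = ρ := by
    simp only [σ]
    rw [push_add, ← push_comp, ← push_comp, biprod.inl_fst, biprod.inr_fst, push_id, T.zero_push,
      add_zero]
  obtain ⟨N, hN, e, he⟩ := T.exists_lift_first hn hV biprod.fst (hσ.symm ▸ hX)
  have hzero : pull T.E X.last σ = 0 := by
    simp only [σ]
    rw [pull_add, ← push_pull, ← push_pull, hθ, (T.exangle ρ X hX).pull_last, push_zero, push_zero,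
      add_zero]
  obtain ⟨k, hk⟩ := (push_eq_zero_iff hN biprod.snd).1 (by rw [hzero, push_zero])
  let c : A ⟶ D := biprod.inr ≫ e.inv ≫ k
  have h1 : biprod.fst ≫ c + V.first ≫ biprod.inl ≫ e.inv ≫ k = biprod.snd := by
    have : N.first = biprod.lift V.first biprod.fst ≫ e.inv := by rw [← he]; simp
    rw [← hk, this, biprod.lift_eq]
    simp [c, add_comm]
  have h2 : push T.E (biprod.snd - biprod.fst ≫ c) σ = 0 :=
    (push_eq_zero_iff hV _).2 ⟨biprod.inl ≫ e.inv ≫ k, by rw [← h1]; abel⟩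
  refine ⟨c, ?_⟩
  rw [T.push_sub_eq_zero_iff, push_comp, hσ] at h2
  rw [← h2]
  simp only [σ]
  rw [push_add, ← push_comp, ← push_comp, biprod.inl_snd, biprod.inr_snd, push_id, T.zero_push,
    zero_add]

/-- The identity of `P` lifts along the last map of a realization, so `θ = 1^* θ` vanishes. -/
theorem eq_zero_of_proj {P A : C} (hP : T.proj P) (θ : (T.E.obj (op P)).obj A) : θ = 0 := by
  obtain ⟨X, hX⟩ := T.exists_realization θ
  have := (pull_eq_zero_iff hX (𝟙 P)).2 (hP A P θ X hX (𝟙 P))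
  rwa [pull_id] at this

theorem eq_zero_of_inj {I B : C} (hI : T.inj I) (θ : (T.E.obj (op B)).obj I) : θ = 0 := by
  obtain ⟨X, hX⟩ := T.exists_realization θ
  have := (push_eq_zero_iff hX (𝟙 I)).2 (hI I B θ X hX (𝟙 I))
  rwa [push_id] at this

theorem pull_eq_of_idealRel {A B B' : C} {b b' : B' ⟶ B} (h : idealRel T.proj b b')
    (δ : (T.E.obj (op B)).obj A) : pull T.E b δ = pull T.E b' δ := by
  obtain ⟨Z, hZ, p, q, h⟩ := h
  rw [← T.pull_sub_eq_zero_iff, h, pull_comp, eq_zero_of_proj hZ (pull T.E q δ), pull_zero]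

theorem push_eq_of_idealRel {A A' B : C} {a a' : A ⟶ A'} (h : idealRel T.inj a a')
    (δ : (T.E.obj (op B)).obj A) : push T.E a δ = push T.E a' δ := by
  obtain ⟨Z, hZ, p, q, h⟩ := h
  rw [← T.push_sub_eq_zero_iff, h, push_comp, eq_zero_of_inj hZ (push T.E p δ), push_zero]

theorem Exangle.exists_hom (U V : Exangle T) (a : U.A ⟶ V.A) (b : U.B ⟶ V.B)
    (h : push T.E a U.δ = pull T.E b V.δ) : ∃ φ : U ⟶ V, φ.a = a ∧ φ.b = b := by
  obtain ⟨f, hf⟩ := T.lift U.δ V.δ U.X V.X U.distinguished V.distinguished a b h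
  exact ⟨⟨f, a, b, hf, h⟩, rfl, rfl⟩

end NExangulated

/-! ### The ideal quotients. -/

section Quotients

variable {C : Type u} [Category.{v} C] [Preadditive C] [HasZeroObject C] [HasBinaryBiproducts C]
  (P : ObjectProperty C) [SumClosed P]

instance : (toQuotient P).Additive where
  map_add := rfl

theorem toQuotient_map_eq_iff {X Y : C} (f g : X ⟶ Y) :
    (toQuotient P).map f = (toQuotient P).map g ↔ idealRel P f g :=
  Quotient.functor_map_eq_iff _ _ _

theorem toQuotient_map_eq_zero {X Z Y : C} (hZ : P Z) (p : X ⟶ Z) (q : Z ⟶ Y) :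
    (toQuotient P).map (p ≫ q) = 0 :=
  (toQuotient_map_eq_iff P _ 0).2 ⟨Z, hZ, p, q, sub_zero _⟩

instance : HasBinaryBiproducts (IdealQuotient P) where
  has_binary_biproduct X Y :=
    HasBinaryBiproduct.mk
      ⟨(toQuotient P).mapBinaryBicone (BinaryBiproduct.bicone X.as Y.as),
        isBinaryBilimitOfTotal _
          (congrArg (toQuotient P).map (biprod.total (X := X.as) (Y := Y.as)))⟩

end Quotients

/-! ### Extension functors as modules over the quotients, and the two families of cyclic submodules.
-/

namespace NExangulated

variable {C : Type u} [Category.{v} C] [Preadditive C] [HasZeroObject C] [HasBinaryBiproducts C]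
  {n : ℕ} (T : NExangulated C n)

/-- The functor `A ↦ 𝔼(-,A)`, with values in the `C/[P]`-modules. -/
def extContra : C ⥤ (IdealQuotient T.proj)ᵒᵖ ⥤ AddCommGrpCat.{v} :=
  (CategoryTheory.Quotient.lift (idealRel T.proj) T.E.rightOp fun X Y f g h => by
    apply Quiver.Hom.unop_inj
    ext A δ
    exact pull_eq_of_idealRel h δ).leftOp.flip

/-- The functor `B ↦ 𝔼(B,-)`, with values in the `(C/[I])ᵒᵖ`-modules. -/
def extCov : Cᵒᵖ ⥤ (IdealQuotient T.inj)ᵒᵖᵒᵖ ⥤ AddCommGrpCat.{v} :=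
  (CategoryTheory.Quotient.lift (idealRel T.inj) T.E.flip fun X Y f g h => by
    ext B δ
    exact push_eq_of_idealRel (B := B.unop) h δ).flip ⋙
  (Functor.whiskeringLeft _ _ _).obj (unopUnop (IdealQuotient T.inj))

instance additive_extContra_obj (A : C) : (T.extContra.obj A).Additive where
  map_add {X Y f g} := by
    obtain ⟨f', hf⟩ := (toQuotient T.proj).map_surjective f.unop
    obtain ⟨g', hg⟩ := (toQuotient T.proj).map_surjective g.unop
    obtain rfl : _ = f := congrArg Quiver.Hom.op hf
    obtain rfl : _ = g := congrArg Quiver.Hom.op hg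
    ext δ
    exact T.add_pull f' g' δ

instance additive_extCov_obj (B : Cᵒᵖ) : (T.extCov.obj B).Additive where
  map_add {X Y f g} := by
    obtain ⟨f', hf⟩ := (toQuotient T.inj).map_surjective f.unop.unop
    obtain ⟨g', hg⟩ := (toQuotient T.inj).map_surjective g.unop.unop
    obtain rfl : _ = f := congrArg (fun k => Quiver.Hom.op (Quiver.Hom.op k)) hf
    obtain rfl : _ = g := congrArg (fun k => Quiver.Hom.op (Quiver.Hom.op k)) hg
    ext δ
    exact T.add_push f' g' δ

/-- The left end of a distinguished `n`-exangle. -/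
def leftEnd : Exangle T ⥤ C where
  obj U := U.A
  map φ := Exangle.Hom.a φ
  map_id _ := rfl
  map_comp _ _ := rfl

/-- The right end of a distinguished `n`-exangle. -/
def rightEnd : Exangle T ⥤ C where
  obj U := U.B
  map φ := Exangle.Hom.b φ
  map_id _ := rfl
  map_comp _ _ := rfl

variable {T}

/-- The contravariant defect of `U` is the submodule of `𝔼(-,A)` generated by the extension. -/
def contraGenerators (hn : 0 < n) (hP : T.EnoughProjectives) :
    Generators (T.leftEnd ⋙ T.extContra) where
  additive U := T.additive_extContra_obj U.A
  gen U := (toQuotient T.proj).obj U.B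
  elt U := U.δ
  compat {U V} φ := ⟨(toQuotient T.proj).map (Exangle.Hom.b φ), Exangle.Hom.comm φ⟩
  presented U := by
    refine ⟨_, (toQuotient T.proj).map U.X.last, ?_⟩
    rintro ⟨Z⟩ g
    obtain ⟨g, rfl⟩ := (toQuotient T.proj).map_surjective (X := Z) g
    constructor
    · intro h
      obtain ⟨k, rfl⟩ := (pull_eq_zero_iff U.distinguished g).1 h
      exact ⟨(toQuotient T.proj).map k, ((toQuotient T.proj).map_comp _ _).symm⟩
    · rintro ⟨k, hk⟩
      obtain ⟨k, rfl⟩ := (toQuotient T.proj).map_surjective (X := Z) k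
      rw [← Functor.map_comp] at hk
      rw [← hk]
      exact (pull_eq_zero_iff U.distinguished (k ≫ U.X.last)).2 ⟨k, rfl⟩
  full {U V} b hb := by
    obtain ⟨b, rfl⟩ := (toQuotient T.proj).map_surjective (X := U.B) b
    have h := hb _ ((toQuotient T.proj).map U.X.last)
      ((pull_eq_zero_iff U.distinguished _).2 ⟨𝟙 _, Category.id_comp _⟩)
    rw [← Functor.map_comp] at h
    have h' : pull T.E U.X.last (pull T.E b V.δ) = 0 := (pull_comp _ _ _ _).symm.trans h
    obtain ⟨a, ha⟩ := exists_push_eq hn U.distinguished _ h'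
    obtain ⟨φ, rfl, -⟩ := Exangle.exists_hom U V a b ha
    exact ⟨φ, ha⟩
  essSurj {X Y} l := by
    obtain ⟨X⟩ := X
    obtain ⟨Y⟩ := Y
    obtain ⟨l, rfl⟩ := (toQuotient T.proj).map_surjective (X := X) (Y := Y) l
    -- The cone built from `K` and `l` has last map `[l, K.last]` on `X ⊞ Kₙ`. Its second component
    -- vanishes modulo projectives, since `Kₙ` is projective.
    obtain ⟨A, ρ, K, hK, hproj⟩ := hP Y
    obtain ⟨L, hL⟩ := T.exists_realization (pull T.E l ρ)
    obtain ⟨M, hM, e, he⟩ := exists_desc_last hn hK l hL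
    refine ⟨⟨_, _, _, M, hM⟩, Iso.refl _, ?_⟩
    rintro ⟨Z⟩ g
    obtain ⟨g, rfl⟩ := (toQuotient T.proj).map_surjective (X := Z) g
    rw [Iso.refl_hom, Category.comp_id]
    refine (pull_eq_zero_iff hM g).trans ⟨?_, ?_⟩
    · rintro ⟨k, hk⟩
      refine ⟨(toQuotient T.proj).map (k ≫ e.hom ≫ biprod.fst), ?_⟩
      rw [← Functor.map_comp, toQuotient_map_eq_iff]
      refine ⟨K.K.X n, hproj n hn le_rfl, -(k ≫ e.hom ≫ biprod.snd), K.last, ?_⟩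
      rw [← hk, he, biprod.desc_eq]
      simp
    · rintro ⟨k, hk⟩
      obtain ⟨k, rfl⟩ := (toQuotient T.proj).map_surjective (X := Z) (Y := X) k
      rw [← Functor.map_comp, eq_comm, toQuotient_map_eq_iff] at hk
      obtain ⟨Q, hQ, p, q, h⟩ := hk
      -- Conversely, an error term factoring through a projective lifts along `K.last`, so it is
      -- absorbed by the summand `Kₙ`.
      obtain ⟨r, hr⟩ := hQ _ _ _ _ hK q
      refine ⟨biprod.lift k (p ≫ r) ≫ e.inv, ?_⟩
      rw [he]
      simp only [Category.assoc, Iso.inv_hom_id_assoc, biprod.lift_desc, hr, ← h]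
      abel

/-- The covariant defect of `U` is the submodule of `𝔼(B,-)` generated by the extension. -/
def covGenerators (hn : 0 < n) (hI : T.EnoughInjectives) :
    Generators (T.rightEnd.op ⋙ T.extCov) where
  additive U := T.additive_extCov_obj (op U.unop.B)
  gen U := op ((toQuotient T.inj).obj U.unop.A)
  elt U := U.unop.δ
  compat {U V} φ := ⟨((toQuotient T.inj).map (Exangle.Hom.a φ.unop)).op,
    (Exangle.Hom.comm φ.unop).symm⟩
  presented U := by
    refine ⟨_, ((toQuotient T.inj).map U.unop.X.first).op, ?_⟩
    rintro ⟨⟨Z⟩⟩ g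
    obtain ⟨g, rfl⟩ : ∃ m, Quiver.Hom.op m = g := ⟨g.unop, rfl⟩
    obtain ⟨g, rfl⟩ := (toQuotient T.inj).map_surjective (Y := Z) g
    constructor
    · intro h
      obtain ⟨k, rfl⟩ := (push_eq_zero_iff U.unop.distinguished g).1 h
      exact ⟨((toQuotient T.inj).map k).op,
        congrArg Quiver.Hom.op ((toQuotient T.inj).map_comp _ _).symm⟩
    · rintro ⟨k, hk⟩
      obtain ⟨k, rfl⟩ : ∃ m, Quiver.Hom.op m = k := ⟨k.unop, rfl⟩
      obtain ⟨k, rfl⟩ := (toQuotient T.inj).map_surjective (Y := Z) k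
      rw [← op_comp, ← Functor.map_comp] at hk
      rw [← hk]
      exact (push_eq_zero_iff U.unop.distinguished (U.unop.X.first ≫ k)).2 ⟨k, rfl⟩
  full {U V} a ha := by
    obtain ⟨a, rfl⟩ : ∃ m, Quiver.Hom.op m = a := ⟨a.unop, rfl⟩
    obtain ⟨a, rfl⟩ := (toQuotient T.inj).map_surjective (X := V.unop.A) (Y := U.unop.A) a
    have h := ha _ ((toQuotient T.inj).map U.unop.X.first).op
      ((push_eq_zero_iff U.unop.distinguished _).2 ⟨𝟙 _, Category.comp_id _⟩)
    rw [← op_comp, ← Functor.map_comp] at h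
    have h' : push T.E U.unop.X.first (push T.E a V.unop.δ) = 0 :=
      (push_comp _ _ _ _).symm.trans h
    obtain ⟨b, hb⟩ := exists_pull_eq hn U.unop.distinguished _ h'
    obtain ⟨φ, -, rfl⟩ := Exangle.exists_hom V.unop U.unop a b hb.symm
    exact ⟨φ.op, hb⟩
  essSurj {X Y} l := by
    obtain ⟨⟨X⟩⟩ := X
    obtain ⟨⟨Y⟩⟩ := Y
    obtain ⟨l, rfl⟩ : ∃ m, Quiver.Hom.op m = l := ⟨l.unop, rfl⟩
    obtain ⟨l, rfl⟩ := (toQuotient T.inj).map_surjective (X := Y) (Y := X) l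
    obtain ⟨B, ρ, K, hK, hinj⟩ := hI Y
    obtain ⟨L, hL⟩ := T.exists_realization (push T.E l ρ)
    obtain ⟨N, hN, e, he⟩ := exists_lift_first hn hK l hL
    have he' : N.first = biprod.lift K.first l ≫ e.inv := by rw [← he]; simp
    refine ⟨op ⟨_, _, _, N, hN⟩, Iso.refl _, ?_⟩
    rintro ⟨⟨Z⟩⟩ g
    obtain ⟨g, rfl⟩ : ∃ m, Quiver.Hom.op m = g := ⟨g.unop, rfl⟩
    obtain ⟨g, rfl⟩ := (toQuotient T.inj).map_surjective (Y := Z) g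
    rw [Iso.refl_hom, Category.comp_id]
    refine (push_eq_zero_iff hN g).trans ⟨?_, ?_⟩
    · rintro ⟨k, hk⟩
      refine ⟨((toQuotient T.inj).map (biprod.inr ≫ e.inv ≫ k)).op, ?_⟩
      rw [← op_comp, ← Functor.map_comp]
      congr 1
      rw [toQuotient_map_eq_iff]
      refine ⟨K.K.X 1, hinj 1 le_rfl hn, K.first, -(biprod.inl ≫ e.inv ≫ k), ?_⟩
      rw [← hk, he', biprod.lift_eq]
      simp
    · rintro ⟨k, hk⟩
      obtain ⟨k, rfl⟩ : ∃ m, Quiver.Hom.op m = k := ⟨k.unop, rfl⟩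
      obtain ⟨k, rfl⟩ := (toQuotient T.inj).map_surjective (X := X) (Y := Z) k
      rw [← op_comp, ← Functor.map_comp] at hk
      replace hk := Quiver.Hom.op_inj hk
      rw [eq_comm, toQuotient_map_eq_iff] at hk
      obtain ⟨Q, hQ, p, q, h⟩ := hk
      obtain ⟨r, hr⟩ := hQ _ _ _ _ hK p
      refine ⟨e.hom ≫ biprod.desc (r ≫ q) k, ?_⟩
      rw [he']
      simp only [Category.assoc, Iso.inv_hom_id_assoc, biprod.lift_desc, reassoc_of% hr, ← h]
      abel

end NExangulated

/-! ### Dualities from a common quotient, their restrictions, and natural isomorphisms along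
resolutions. -/

section AbstractDuality

/-- A functor and a contravariant functor with the same domain, both full and essentially surjective
and identifying the same morphisms, induce a duality between their targets. -/
theorem exists_duality {S A B : Type*} [Category S] [Category A] [Category B] (F : S ⥤ A)
    (G : Sᵒᵖ ⥤ B) [F.Full] [F.EssSurj] [G.Full] [G.EssSurj]
    (h : ∀ {U V : S} (φ ψ : U ⟶ V), F.map φ = F.map ψ ↔ G.map φ.op = G.map ψ.op) :
    ∃ Φ : Aᵒᵖ ≌ B, Nonempty (F.op ⋙ Φ.functor ≅ G) := by
  -- By `h`, the relations defined by `F.op` and `G` coincide; both functors therefore factor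
  -- through the same quotient, as equivalences.
  let r := G.homRel
  have hr : ∀ {X Y : Sᵒᵖ} (f g : X ⟶ Y), F.op.map f = F.op.map g ↔ G.map f = G.map g :=
    fun f g => ⟨fun e => (h f.unop g.unop).1 (Quiver.Hom.op_inj e),
      fun e => congrArg Quiver.Hom.op ((h f.unop g.unop).2 e)⟩
  let q := CategoryTheory.Quotient.functor r
  let F' : CategoryTheory.Quotient r ⥤ Aᵒᵖ :=
    CategoryTheory.Quotient.lift r F.op fun _ _ f g e => (hr f g).2 e
  let G' : CategoryTheory.Quotient r ⥤ B :=
    CategoryTheory.Quotient.lift r G fun _ _ f g e => e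
  have hFfaith : F'.Faithful := ⟨fun {X Y f g} e => by
    obtain ⟨f, rfl⟩ := q.map_surjective (X := X.as) (Y := Y.as) f
    obtain ⟨g, rfl⟩ := q.map_surjective (X := X.as) (Y := Y.as) g
    exact CategoryTheory.Quotient.sound r ((hr f g).1 e)⟩
  have hGfaith : G'.Faithful := ⟨fun {X Y f g} e => by
    obtain ⟨f, rfl⟩ := q.map_surjective (X := X.as) (Y := Y.as) f
    obtain ⟨g, rfl⟩ := q.map_surjective (X := X.as) (Y := Y.as) g
    exact CategoryTheory.Quotient.sound r e⟩
  have hFfull : F'.Full := ⟨fun {X Y} f => by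
    obtain ⟨g, hg⟩ := F.op.map_surjective (X := X.as) (Y := Y.as) f
    exact ⟨q.map g, hg⟩⟩
  have hGfull : G'.Full := ⟨fun {X Y} f => by
    obtain ⟨g, hg⟩ := G.map_surjective (X := X.as) (Y := Y.as) f
    exact ⟨q.map g, hg⟩⟩
  have hFess : F'.EssSurj := ⟨fun X => ⟨q.obj (F.op.objPreimage X), ⟨F.op.objObjPreimageIso X⟩⟩⟩
  have hGess : G'.EssSurj := ⟨fun X => ⟨q.obj (G.objPreimage X), ⟨G.objObjPreimageIso X⟩⟩⟩
  have : F'.IsEquivalence := {}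
  have : G'.IsEquivalence := {}
  exact ⟨F'.asEquivalence.symm.trans G'.asEquivalence,
    ⟨Functor.isoWhiskerLeft q (Functor.isoWhiskerRight F'.asEquivalence.unitIso.symm G')⟩⟩

theorem additive_of_full_essSurj {S A B : Type*} [Category S] [Category A] [Category B]
    [Preadditive A] [Preadditive B] (F : S ⥤ A) [F.Full] [F.EssSurj] (H : A ⥤ B)
    (h : ∀ {U V : S} (φ ψ χ : U ⟶ V), F.map φ + F.map ψ = F.map χ →
      H.map (F.map φ) + H.map (F.map ψ) = H.map (F.map χ)) : H.Additive where
  map_add {X Y f g} := by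
    let i := F.objObjPreimageIso X
    let j := F.objObjPreimageIso Y
    obtain ⟨φ, hφ⟩ := F.map_surjective (i.hom ≫ f ≫ j.inv)
    obtain ⟨ψ, hψ⟩ := F.map_surjective (i.hom ≫ g ≫ j.inv)
    obtain ⟨χ, hχ⟩ := F.map_surjective (i.hom ≫ (f + g) ≫ j.inv)
    have key := h φ ψ χ (by rw [hφ, hψ, hχ]; simp)
    rw [hφ, hψ, hχ] at key
    simp only [Functor.map_comp, ← Preadditive.comp_add, ← Preadditive.add_comp] at key
    rw [cancel_epi, cancel_mono] at key
    exact key.symm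

theorem exists_restricted_duality {A B : Type*} [Category A] [Category B] (Φ : Aᵒᵖ ≌ B)
    (P : ObjectProperty A) (Q : ObjectProperty B)
    (h : ∀ X, P X ↔ Q (Φ.functor.obj (op X))) [Q.IsClosedUnderIsomorphisms] :
    ∃ Φ' : P.FullSubcategoryᵒᵖ ≌ Q.FullSubcategory,
      Nonempty (Φ'.functor ⋙ Q.ι ≅ P.ι.op ⋙ Φ.functor) := by
  let H : P.FullSubcategoryᵒᵖ ⥤ Q.FullSubcategory :=
    Q.lift (P.ι.op ⋙ Φ.functor) fun X => (h _).1 X.unop.property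
  have : H.EssSurj := ⟨fun Y => by
    let X := Φ.functor.objPreimage Y.obj
    let e := Φ.functor.objObjPreimageIso Y.obj
    exact ⟨op ⟨X.unop, (h _).2 (Q.prop_of_iso e.symm Y.property)⟩, ⟨Q.isoMk e⟩⟩⟩
  have : H.IsEquivalence := {}
  exact ⟨H.asEquivalence, ⟨Iso.refl _⟩⟩

/-- The choice `ω` of resolutions need not be functorial: fullness of `F` lifts each morphism to
some `φ`, and `h` says that every such lift gives the naturality square. -/
theorem nonempty_iso_of_resolutions {S A B B' K : Type*} [Category S] [Category A] [Category B]
    [Category B'] [Category K] {F : S ⥤ A} [F.Full] {G : Sᵒᵖ ⥤ B} {Φ : Aᵒᵖ ⥤ B}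
    (i : F.op ⋙ Φ ≅ G) (R : B ⥤ B') (H₁ : K ⥤ A) (H₂ : Kᵒᵖ ⥤ B') (ω : K → S)
    (α : ∀ k, F.obj (ω k) ≅ H₁.obj k) (β : ∀ k, R.obj (G.obj (op (ω k))) ≅ H₂.obj (op k))
    (h : ∀ {k k' : K} (f : k ⟶ k') (φ : ω k ⟶ ω k'),
      F.map φ ≫ (α k').hom = (α k).hom ≫ H₁.map f →
      R.map (G.map φ.op) ≫ (β k).hom = (β k').hom ≫ H₂.map f.op) :
    Nonempty (H₁.op ⋙ Φ ⋙ R ≅ H₂) := by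
  refine ⟨NatIso.ofComponents (fun k => R.mapIso (Φ.mapIso (α k.unop).op ≪≫
    i.app (op (ω k.unop))) ≪≫ β k.unop) ?_⟩
  intro X Y f
  obtain ⟨φ, hφ⟩ := F.map_surjective ((α Y.unop).hom ≫ H₁.map f.unop ≫ (α X.unop).inv)
  have hφ' : F.map φ ≫ (α X.unop).hom = (α Y.unop).hom ≫ H₁.map f.unop := by
    rw [hφ]; simp
  have h₁ := h f.unop φ hφ'
  have h₂ := i.hom.naturality φ.op
  have h₃ : Φ.map (H₁.map f.unop).op ≫ Φ.map (α Y.unop).hom.op =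
      Φ.map (α X.unop).hom.op ≫ Φ.map (F.map φ).op := by
    rw [← Φ.map_comp, ← Φ.map_comp, ← op_comp, ← op_comp, hφ']
  change R.map (Φ.map (H₁.map f.unop).op) ≫ R.map (Φ.map (α Y.unop).hom.op ≫
    i.hom.app (op (ω Y.unop))) ≫ (β Y.unop).hom =
    (R.map (Φ.map (α X.unop).hom.op ≫ i.hom.app (op (ω X.unop))) ≫ (β X.unop).hom) ≫ H₂.map f
  change Φ.map (F.map φ).op ≫ i.hom.app _ = _ at h₂
  rw [Category.assoc]
  refine Eq.trans ?_ (congrArg (R.map (Φ.map (α X.unop).hom.op ≫ i.hom.app _) ≫ ·) h₁)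
  rw [← R.map_comp_assoc, reassoc_of% h₃, h₂, ← R.map_comp_assoc, Category.assoc]

end AbstractDuality

theorem isFinPres_of_iso {D : Type u} [Category.{v} D] [Preadditive D]
    {M N : Dᵒᵖ ⥤ AddCommGrpCat.{v}} (e : M ≅ N) (hM : isFinPres D M) : isFinPres D N := by
  obtain ⟨_, X, Y, f, p, hp⟩ := hM
  have hb : ∀ Z, Function.Bijective (e.hom.app Z) := fun Z =>
    ConcreteCategory.bijective_of_isIso (e.hom.app Z)
  refine ⟨additive_of_surjective e.hom fun Z => (hb Z).2, X, Y, f, p ≫ e.hom, fun Z => ⟨?_, ?_⟩⟩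
  · intro x
    rw [← (hp Z).1 x]
    exact map_eq_zero_iff (e.hom.app Z).hom (hb Z).1
  · exact (hb Z).2.comp (hp Z).2

namespace Generators

variable {D : Type u} [Category.{v} D] [Preadditive D] {S : Type*} [Category S]
  {W : S ⥤ Dᵒᵖ ⥤ AddCommGrpCat.{v}} (G : Generators W)

/-- A generator with zero annihilator generates a free, that is representable, module. -/
theorem isIso_proj (U : S) (h : ∀ (T : D) (g : T ⟶ G.gen U),
    (W.obj U).map g.op (G.elt U) = 0 → g = 0) : IsIso (G.proj U) := by
  have : ∀ T, Mono ((G.proj U).app T) := fun T => by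
    rw [AddCommGrpCat.mono_iff_injective, injective_iff_map_eq_zero]
    exact fun g hg => h _ _ ((G.proj_eq_zero_iff U g).1 hg)
  have : Mono (G.proj U) := NatTrans.mono_of_mono_app _
  exact isIso_of_mono_of_epi _

theorem isIso_incl (U : S) (h : ∀ (T : D) (x : (W.obj U).obj (op T)), ∃ g : T ⟶ G.gen U,
    (W.obj U).map g.op (G.elt U) = x) : IsIso (G.incl U) := by
  have : Epi (G.incl U) := epi_of_surjective _ fun T x => by
    obtain ⟨g, rfl⟩ := h T.unop x
    exact ⟨(G.proj U).app T g, G.incl_proj U g⟩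
  exact isIso_of_mono_of_epi _

end Generators


theorem comp_inv_eq_inv_comp_iff {A : Type*} [Category A] {X X' Y Y' : A} {p : X ⟶ X'} {q : Y ⟶ Y'}
    [IsIso p] [IsIso q] {m : X' ⟶ Y'} {g : X ⟶ Y} :
    m ≫ inv q = inv p ≫ g ↔ p ≫ m = g ≫ q := by
  rw [IsIso.comp_inv_eq, Category.assoc, IsIso.eq_inv_comp]

instance {A : Type*} [Category A] : (isProjective A).IsClosedUnderIsomorphisms :=
  ⟨fun e h => Projective.of_iso e h⟩

instance {A : Type*} [Category A] : (isInjective A).IsClosedUnderIsomorphisms :=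
  ⟨fun e h => Injective.of_iso e h⟩

namespace NExangulated

variable {C : Type u} [Category.{v} C] [Preadditive C] [HasZeroObject C] [HasBinaryBiproducts C]
  {n : ℕ} {T : NExangulated C n} (hn : 0 < n)

/-! ### Comparison with the cokernel definition of the defects, and the duality. -/

section Defects

/-- The presentation of the contravariant defect by a representable functor. -/
noncomputable def contraPresentation (hP : T.EnoughProjectives) (U : Exangle T) :
    preadditiveYoneda.obj U.B ⟶
      ((contraGenerators hn hP).functor ⋙ restrictRight T.proj).obj U where
  app Z := AddCommGrpCat.ofHom ((toQuotient T.proj).mapAddHom) ≫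
    ((contraGenerators hn hP).proj U).app (op ((toQuotient T.proj).obj Z.unop))
  naturality X Y f := by
    ext (g : X.unop ⟶ U.B)
    exact (congrArg _ ((toQuotient T.proj).map_comp f.unop g)).trans
      (ConcreteCategory.congr_hom (((contraGenerators hn hP).proj U).naturality
        ((toQuotient T.proj).map f.unop).op) ((toQuotient T.proj).map g))

theorem contraPresentation_surjective (hP : T.EnoughProjectives) (U : Exangle T) (Z : Cᵒᵖ) :
    Function.Surjective ((contraPresentation hn hP U).app Z) := by
  intro x
  obtain ⟨g, rfl⟩ := (contraGenerators hn hP).proj_surjective U _ x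
  obtain ⟨g, rfl⟩ := (toQuotient T.proj).map_surjective (X := Z.unop) (Y := U.B) g
  exact ⟨g, rfl⟩

theorem contraPresentation_eq_zero_iff (hP : T.EnoughProjectives) (U : Exangle T) {Z : Cᵒᵖ}
    (g : Z.unop ⟶ U.B) :
    (contraPresentation hn hP U).app Z g = 0 ↔ ∃ k : Z.unop ⟶ U.X.K.X n, k ≫ U.X.last = g :=
  ((contraGenerators hn hP).proj_eq_zero_iff U
    (T := op ((toQuotient T.proj).obj Z.unop)) ((toQuotient T.proj).map g)).trans
    (pull_eq_zero_iff U.distinguished g)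

theorem contraPresentation_naturality (hP : T.EnoughProjectives) {U V : Exangle T} (φ : U ⟶ V) :
    contraPresentation hn hP U ≫
        ((contraGenerators hn hP).functor ⋙ restrictRight T.proj).map φ =
      preadditiveYoneda.map (Exangle.Hom.b φ) ≫ contraPresentation hn hP V := by
  have h := (contraGenerators hn hP).proj_map φ
    ((toQuotient T.proj).map (Exangle.Hom.b φ)) (Exangle.Hom.comm φ)
  ext Z (g : Z.unop ⟶ U.B)
  exact (ConcreteCategory.congr_hom (NatTrans.congr_app h
    (op ((toQuotient T.proj).obj Z.unop))) ((toQuotient T.proj).map g)).trans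
    (congrArg (fun k : (toQuotient T.proj).obj Z.unop ⟶ (toQuotient T.proj).obj V.B =>
      ((contraGenerators hn hP).proj V).app (op ((toQuotient T.proj).obj Z.unop)) k)
      ((toQuotient T.proj).map_comp g (Exangle.Hom.b φ)).symm)

/-- The cyclic submodule and the cokernel are quotients of `C(-,B)` with the same kernel, the
morphisms factoring through the last differential. -/
theorem nonempty_iso_contraDefect (hP : T.EnoughProjectives) :
    Nonempty ((contraGenerators hn hP).functor ⋙ restrictRight T.proj ≅ contraDefect T) := by
  have key : ∀ U : Exangle T, ∃ e : ((contraGenerators hn hP).functor ⋙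
      restrictRight T.proj).obj U ≅ (contraDefect T).obj U,
      contraPresentation hn hP U ≫ e.hom = cokernel.π (preadditiveYoneda.map U.X.last) := fun U =>
    exists_iso_of_surjective _ _ (contraPresentation_surjective hn hP U)
      (cokernel_app_surjective _) fun Z g =>
        (contraPresentation_eq_zero_iff hn hP U g).trans
          (cokernel_app_exact (preadditiveYoneda.map U.X.last) Z g).symm
  choose e he using key
  refine ⟨NatIso.ofComponents e fun {U V} φ => ?_⟩
  have := epi_of_surjective _ (contraPresentation_surjective hn hP U)
  rw [← cancel_epi (contraPresentation hn hP U), ← Category.assoc,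
    contraPresentation_naturality, Category.assoc, he, ← Category.assoc, he]
  exact (cokernel.π_desc _ _ _).symm

/-- The presentation of the covariant defect by a corepresentable functor. -/
noncomputable def covPresentation (hI : T.EnoughInjectives) (U : (Exangle T)ᵒᵖ) :
    preadditiveCoyoneda.obj (op U.unop.A) ⟶
      ((covGenerators hn hI).functor ⋙ restrictLeft T.inj).obj U where
  app Z := AddCommGrpCat.ofHom (AddMonoidHom.mk' (fun g : U.unop.A ⟶ Z =>
      ((toQuotient T.inj).map g).op) fun _ _ => rfl) ≫
    ((covGenerators hn hI).proj U).app (op (op ((toQuotient T.inj).obj Z)))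
  naturality X Y f := by
    ext (g : U.unop.A ⟶ X)
    exact (congrArg _ (congrArg Quiver.Hom.op ((toQuotient T.inj).map_comp g f))).trans
      (ConcreteCategory.congr_hom (((covGenerators hn hI).proj U).naturality
        ((toQuotient T.inj).map f).op.op) ((toQuotient T.inj).map g).op)

theorem covPresentation_surjective (hI : T.EnoughInjectives) (U : (Exangle T)ᵒᵖ) (Z : C) :
    Function.Surjective ((covPresentation hn hI U).app Z) := by
  intro x
  obtain ⟨g, rfl⟩ := (covGenerators hn hI).proj_surjective U _ x
  obtain ⟨g, rfl⟩ : ∃ m, Quiver.Hom.op m = g := ⟨Quiver.Hom.unop g, rfl⟩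
  obtain ⟨g, rfl⟩ := (toQuotient T.inj).map_surjective (X := U.unop.A) (Y := Z) g
  exact ⟨g, rfl⟩

theorem covPresentation_eq_zero_iff (hI : T.EnoughInjectives) (U : (Exangle T)ᵒᵖ) {Z : C}
    (g : U.unop.A ⟶ Z) :
    (covPresentation hn hI U).app Z g = 0 ↔
      ∃ k : U.unop.X.K.X 1 ⟶ Z, U.unop.X.first ≫ k = g :=
  ((covGenerators hn hI).proj_eq_zero_iff U
    (T := op (op ((toQuotient T.inj).obj Z))) ((toQuotient T.inj).map g).op).trans
    (push_eq_zero_iff U.unop.distinguished g)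

theorem covPresentation_naturality (hI : T.EnoughInjectives) {U V : (Exangle T)ᵒᵖ} (φ : U ⟶ V) :
    covPresentation hn hI U ≫
        ((covGenerators hn hI).functor ⋙ restrictLeft T.inj).map φ =
      preadditiveCoyoneda.map (Exangle.Hom.a φ.unop).op ≫ covPresentation hn hI V := by
  have h := (covGenerators hn hI).proj_map φ
    ((toQuotient T.inj).map (Exangle.Hom.a φ.unop)).op (Exangle.Hom.comm φ.unop).symm
  ext Z (g : U.unop.A ⟶ Z)
  exact (ConcreteCategory.congr_hom (NatTrans.congr_app h
    (op (op ((toQuotient T.inj).obj Z)))) ((toQuotient T.inj).map g).op).trans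
    (congrArg (fun k : (toQuotient T.inj).obj V.unop.A ⟶ (toQuotient T.inj).obj Z =>
      ((covGenerators hn hI).proj V).app (op (op ((toQuotient T.inj).obj Z))) k.op)
      ((toQuotient T.inj).map_comp (Exangle.Hom.a φ.unop) g).symm)

theorem nonempty_iso_covDefect (hI : T.EnoughInjectives) :
    Nonempty ((covGenerators hn hI).functor ⋙ restrictLeft T.inj ≅ covDefect T) := by
  have key : ∀ U : (Exangle T)ᵒᵖ, ∃ e : ((covGenerators hn hI).functor ⋙
      restrictLeft T.inj).obj U ≅ (covDefect T).obj U,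
      covPresentation hn hI U ≫ e.hom =
        cokernel.π (preadditiveCoyoneda.map U.unop.X.first.op) := fun U =>
    exists_iso_of_surjective _ _ (covPresentation_surjective hn hI U)
      (cokernel_app_surjective _) fun Z g =>
        (covPresentation_eq_zero_iff hn hI U g).trans
          (cokernel_app_exact (preadditiveCoyoneda.map U.unop.X.first.op) Z g).symm
  choose e he using key
  refine ⟨NatIso.ofComponents e fun {U V} φ => ?_⟩
  have := epi_of_surjective _ (covPresentation_surjective hn hI U)
  rw [← cancel_epi (covPresentation hn hI U), ← Category.assoc,
    covPresentation_naturality, Category.assoc, he, ← Category.assoc, he]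
  exact (cokernel.π_desc _ _ _).symm

theorem Exangle.push_eq_iff {U V : Exangle T} (φ ψ : U ⟶ V) :
    push T.E φ.a U.δ = push T.E ψ.a U.δ ↔ pull T.E φ.b V.δ = pull T.E ψ.b V.δ := by
  rw [φ.comm, ψ.comm]

theorem exists_defect_duality (hP : T.EnoughProjectives) (hI : T.EnoughInjectives) :
    ∃ Φ : (FPMod (IdealQuotient T.proj))ᵒᵖ ≌ FPMod (IdealQuotient T.inj)ᵒᵖ,
      Φ.functor.Additive ∧
      Nonempty ((contraGenerators hn hP).functor.op ⋙ Φ.functor ≅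
        (covGenerators hn hI).functor) := by
  obtain ⟨Φ, ⟨i⟩⟩ := exists_duality (contraGenerators hn hP).functor
    (covGenerators hn hI).functor fun {U V} φ ψ =>
      ((contraGenerators hn hP).map_eq_iff φ ψ).trans ((Exangle.push_eq_iff φ ψ).trans
        ((covGenerators hn hI).map_eq_iff φ.op ψ.op).symm)
  refine ⟨Φ, additive_of_full_essSurj (contraGenerators hn hP).functor.op Φ.functor
    fun {U V} φ ψ χ h => ?_, ⟨i⟩⟩
  have h₁ : push T.E (Exangle.Hom.a φ.unop) V.unop.δ + push T.E (Exangle.Hom.a ψ.unop) V.unop.δ =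
      push T.E (Exangle.Hom.a χ.unop) V.unop.δ :=
    ((contraGenerators hn hP).map_add_eq_iff φ.unop ψ.unop χ.unop).1 (Quiver.Hom.op_inj h)
  -- Replacing each `a_* δ` by `b^* δ'` turns the sum of maps of contravariant defects into that of
  -- covariant ones.
  rw [Exangle.Hom.comm, Exangle.Hom.comm, Exangle.Hom.comm] at h₁
  have h₂ := ((covGenerators hn hI).map_add_eq_iff φ ψ χ).2 h₁
  have hi : ∀ θ : U ⟶ V, Φ.functor.map ((contraGenerators hn hP).functor.op.map θ) =
      i.hom.app U ≫ (covGenerators hn hI).functor.map θ ≫ i.inv.app V := fun θ => by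
    rw [← Category.assoc, ← i.hom.naturality θ, Category.assoc, Iso.hom_inv_id_app,
      Category.comp_id]
    rfl
  rw [hi, hi, hi, ← h₂]
  simp only [Preadditive.comp_add, Preadditive.add_comp]

end Defects

/-! ### Exangles with projective or injective middle terms: the values of the duality on
representables and on `𝔼`. -/

section Resolutions

/-- A distinguished `n`-exangle ending in `B` with projective middle terms. -/
noncomputable def projResolution (hP : T.EnoughProjectives) (B : C) : Exangle T :=
  ⟨(hP B).choose, B, (hP B).choose_spec.choose, (hP B).choose_spec.choose_spec.choose,
    (hP B).choose_spec.choose_spec.choose_spec.1⟩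

theorem proj_projResolution (hP : T.EnoughProjectives) (B : C) (i : ℕ) (h₁ : 1 ≤ i) (h₂ : i ≤ n) :
    T.proj ((projResolution hP B).X.K.X i) :=
  (hP B).choose_spec.choose_spec.choose_spec.2 i h₁ h₂

/-- A distinguished `n`-exangle starting in `A` with injective middle terms. -/
noncomputable def injResolution (hI : T.EnoughInjectives) (A : C) : Exangle T :=
  ⟨A, (hI A).choose, (hI A).choose_spec.choose, (hI A).choose_spec.choose_spec.choose,
    (hI A).choose_spec.choose_spec.choose_spec.1⟩

theorem inj_injResolution (hI : T.EnoughInjectives) (A : C) (i : ℕ) (h₁ : 1 ≤ i) (h₂ : i ≤ n) :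
    T.inj ((injResolution hI A).X.K.X i) :=
  (hI A).choose_spec.choose_spec.choose_spec.2 i h₁ h₂

variable (hP : T.EnoughProjectives) (hI : T.EnoughInjectives)

/-- A morphism annihilating the extension factors through the projective object `Xₙ`, hence is zero
in `C/[P]`. -/
theorem isIso_proj_projResolution (B : C) :
    IsIso ((contraGenerators hn hP).proj (projResolution hP B)) := by
  refine Generators.isIso_proj _ _ ?_
  rintro ⟨Z⟩ g hg
  obtain ⟨g, rfl⟩ := (toQuotient T.proj).map_surjective (X := Z) (Y := B) g
  obtain ⟨k, rfl⟩ := (pull_eq_zero_iff (projResolution hP B).distinguished g).1 hg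
  exact toQuotient_map_eq_zero _ (proj_projResolution hP B n hn le_rfl) _ _

/-- Extensions of the projective object `Xₙ` vanish, so by `exists_push_eq` every element of
`𝔼(B,Z)` is a pushout of the given extension. -/
theorem isIso_incl_projResolution (B : C) :
    IsIso ((covGenerators hn hI).incl (op (projResolution hP B))) := by
  refine Generators.isIso_incl _ _ ?_
  rintro ⟨⟨Z⟩⟩ x
  obtain ⟨c, hc⟩ := exists_push_eq hn (projResolution hP B).distinguished (D := Z) x
    (eq_zero_of_proj (proj_projResolution hP B n hn le_rfl) _)
  exact ⟨((toQuotient T.inj).map c).op, hc⟩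

theorem isIso_proj_injResolution (A : C) :
    IsIso ((covGenerators hn hI).proj (op (injResolution hI A))) := by
  refine Generators.isIso_proj _ _ ?_
  rintro ⟨⟨Z⟩⟩ g hg
  obtain ⟨g, rfl⟩ : ∃ m, Quiver.Hom.op m = g := ⟨Quiver.Hom.unop g, rfl⟩
  obtain ⟨g, rfl⟩ := (toQuotient T.inj).map_surjective (X := A) (Y := Z) g
  obtain ⟨k, rfl⟩ := (push_eq_zero_iff (injResolution hI A).distinguished g).1 hg
  exact congrArg Quiver.Hom.op
    (toQuotient_map_eq_zero _ (inj_injResolution hI A 1 le_rfl hn) _ _)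

theorem isIso_incl_injResolution (A : C) :
    IsIso ((contraGenerators hn hP).incl (injResolution hI A)) := by
  refine Generators.isIso_incl _ _ ?_
  rintro ⟨Z⟩ x
  obtain ⟨c, hc⟩ := exists_pull_eq hn (injResolution hI A).distinguished (D := Z) x
    (eq_zero_of_inj (inj_injResolution hI A 1 le_rfl hn) _)
  exact ⟨(toQuotient T.proj).map c, hc⟩

-- `𝔼(-,A)` is the contravariant defect of an exangle starting in `A` with injective middle terms.
include hn hP hI in
theorem isFinPres_extContra (A : C) :
    isFinPres (IdealQuotient T.proj) (T.extContra.obj A) := by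
  have := isIso_incl_injResolution hn hP hI A
  exact isFinPres_of_iso
    (@asIso _ _ _ _ ((contraGenerators hn hP).incl (injResolution hI A)) this)
    ((contraGenerators hn hP).isFinPres _)

/-- The functor `A ↦ 𝔼(-,A)` into the finitely presented modules. -/
def fpExtContra (h : ∀ A, isFinPres (IdealQuotient T.proj) (T.extContra.obj A)) :
    C ⥤ FPMod (IdealQuotient T.proj) :=
  (isFinPres _).lift T.extContra h

variable {Φ : (FPMod (IdealQuotient T.proj))ᵒᵖ ⥤ FPMod (IdealQuotient T.inj)ᵒᵖ}

theorem nonempty_yoneda_iso_ext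
    (i : (contraGenerators hn hP).functor.op ⋙ Φ ≅ (covGenerators hn hI).functor) :
    Nonempty ((toQuotient T.proj ⋙ fpYoneda _).op ⋙ Φ ⋙ restrictLeft T.inj ≅ T.E) := by
  have h₁ := isIso_proj_projResolution hn hP
  have h₂ := isIso_incl_projResolution hn hP hI
  refine nonempty_iso_of_resolutions i (restrictLeft T.inj) (toQuotient T.proj ⋙ fpYoneda _) T.E
    (projResolution hP)
    (fun A => ObjectProperty.isoMk _
      (asIso ((contraGenerators hn hP).proj (projResolution hP A))).symm)
    (fun A => ((Functor.whiskeringLeft _ _ _).obj (toQuotient T.inj ⋙ opOp _)).mapIso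
      (asIso ((covGenerators hn hI).incl (op (projResolution hP A))))) ?_
  intro A A' f φ hφ
  have hφ' : (contraGenerators hn hP).map φ ≫
      inv ((contraGenerators hn hP).proj (projResolution hP A')) =
      inv ((contraGenerators hn hP).proj (projResolution hP A)) ≫
        preadditiveYoneda.map ((toQuotient T.proj).map f) :=
    congrArg InducedCategory.Hom.hom hφ
  -- The right end of the lift `φ` agrees with `f` only modulo projectives, but pulling back
  -- extensions does not see the difference.
  replace hφ' := preadditiveYoneda.map_injective ((cancel_mono _).1
    (((contraGenerators hn hP).proj_map φ ((toQuotient T.proj).map (Exangle.Hom.b φ))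
      (Exangle.Hom.comm φ)).symm.trans (comp_inv_eq_inv_comp_iff.1 hφ')))
  have hb : pull T.E (Exangle.Hom.b φ) (projResolution hP A').δ =
      pull T.E f (projResolution hP A').δ :=
    pull_eq_of_idealRel ((toQuotient_map_eq_iff T.proj _ _).1 hφ') _
  have key : (covGenerators hn hI).map φ.op ≫ (covGenerators hn hI).incl _ =
      (covGenerators hn hI).incl _ ≫ T.extCov.map f.op := by
    rw [Generators.map_incl]
    apply Generators.hom_ext_elt
    have h := (covGenerators hn hI).incl_proj_id (op (projResolution hP A'))
    exact (congrArg ((T.extCov.map (Exangle.Hom.b φ).op).app _) h).trans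
      (hb.trans (congrArg ((T.extCov.map f.op).app _) h).symm)
  exact congrArg (Functor.whiskerLeft (toQuotient T.inj ⋙ opOp _)) key

theorem nonempty_ext_iso_yoneda
    (h : ∀ A, isFinPres (IdealQuotient T.proj) (T.extContra.obj A))
    (i : (contraGenerators hn hP).functor.op ⋙ Φ ≅ (covGenerators hn hI).functor) :
    Nonempty ((fpExtContra h).op ⋙ Φ ⋙ 𝟭 _ ≅ (toQuotient T.inj).op ⋙ fpYoneda _) := by
  have h₁ := isIso_proj_injResolution hn hI
  have h₂ := isIso_incl_injResolution hn hP hI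
  refine nonempty_iso_of_resolutions i (𝟭 _) (fpExtContra h)
    ((toQuotient T.inj).op ⋙ fpYoneda _) (injResolution hI)
    (fun A => ObjectProperty.isoMk _
      (@asIso _ _ _ _ ((contraGenerators hn hP).incl (injResolution hI A)) (h₂ A)))
    (fun A => ObjectProperty.isoMk _
      (asIso ((covGenerators hn hI).proj (op (injResolution hI A)))).symm) ?_
  intro A A' f φ hφ
  have hφ' : (contraGenerators hn hP).map φ ≫
      (contraGenerators hn hP).incl (injResolution hI A') =
      (contraGenerators hn hP).incl (injResolution hI A) ≫ T.extContra.map f :=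
    congrArg InducedCategory.Hom.hom hφ
  -- Only the effect on the generator is known: the left end of `φ` need not be `f`, but both push
  -- the extension to the same element.
  have ha : push T.E (Exangle.Hom.a φ) (injResolution hI A).δ =
      push T.E f (injResolution hI A).δ := by
    have e := ConcreteCategory.congr_hom (NatTrans.congr_app hφ' _)
      (((contraGenerators hn hP).proj (injResolution hI A)).app (op _) (𝟙 _))
    refine ((contraGenerators hn hP).incl_map_proj_id φ).symm.trans (e.trans ?_)
    exact congrArg _ ((contraGenerators hn hP).incl_proj_id (injResolution hI A))
  have key := (covGenerators hn hI).proj_map φ.op ((toQuotient T.inj).map f).op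
    ((Exangle.Hom.comm φ).symm.trans ha)
  apply ObjectProperty.hom_ext
  change (covGenerators hn hI).map φ.op ≫
      inv ((covGenerators hn hI).proj (op (injResolution hI A))) =
    inv ((covGenerators hn hI).proj (op (injResolution hI A'))) ≫
      preadditiveYoneda.map ((toQuotient T.inj).map f).op
  exact comp_inv_eq_inv_comp_iff.2 key

end Resolutions

end NExangulated
end NExang

/-! ### The main theorem. -/

open NExang NExang.NExangulated in
theorem corollary4p13 {C : Type u} [Category.{v} C] [Preadditive C] [HasZeroObject C] [HasBinaryBiproducts C]
    (n : ℕ) (hn : 0 < n) (T : NExangulated C n)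
    (hP : T.EnoughProjectives) (hI : T.EnoughInjectives) :
    ∃ Φ : (FPMod (IdealQuotient T.proj))ᵒᵖ ≌ FPMod (IdealQuotient T.inj)ᵒᵖ,
      Φ.functor.Additive ∧
      (∃ (F : Exangle T ⥤ FPMod (IdealQuotient T.proj))
          (G : (Exangle T)ᵒᵖ ⥤ FPMod (IdealQuotient T.inj)ᵒᵖ),
        F.Full ∧ F.EssSurj ∧
        Nonempty (F ⋙ restrictRight T.proj ≅ contraDefect T) ∧
        Nonempty (G ⋙ restrictLeft T.inj ≅ covDefect T) ∧
        Nonempty (F.op ⋙ Φ.functor ≅ G)) ∧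
      (Even n →
        (∃ Φ₁ : (ProjMod (IdealQuotient T.proj))ᵒᵖ ≌ InjMod (IdealQuotient T.inj)ᵒᵖ,
          Nonempty (Φ₁.functor ⋙ (isInjective (FPMod (IdealQuotient T.inj)ᵒᵖ)).ι ≅
            (isProjective (FPMod (IdealQuotient T.proj))).ι.op ⋙ Φ.functor) ∧
          ∃ Y : C ⥤ ProjMod (IdealQuotient T.proj),
            Nonempty (Y ⋙ (isProjective _).ι ⋙ (isFinPres (IdealQuotient T.proj)).ι ≅
              toQuotient T.proj ⋙ preadditiveYoneda) ∧
            Nonempty (Y.op ⋙ Φ₁.functor ⋙ (isInjective _).ι ⋙ restrictLeft T.inj ≅ T.E)) ∧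
        (∃ Φ₂ : (InjMod (IdealQuotient T.proj))ᵒᵖ ≌ ProjMod (IdealQuotient T.inj)ᵒᵖ,
          Nonempty (Φ₂.functor ⋙ (isProjective (FPMod (IdealQuotient T.inj)ᵒᵖ)).ι ≅
            (isInjective (FPMod (IdealQuotient T.proj))).ι.op ⋙ Φ.functor) ∧
          ∃ J : C ⥤ InjMod (IdealQuotient T.proj),
            Nonempty (J ⋙ (isInjective _).ι ⋙ restrictRight T.proj ≅ T.E.flip) ∧
            Nonempty (J.op ⋙ Φ₂.functor ⋙ (isProjective _).ι ⋙
                (isFinPres (IdealQuotient T.inj)ᵒᵖ).ι ≅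
              (toQuotient T.inj).op ⋙ preadditiveYoneda))) := by
  obtain ⟨Φ, hΦ, ⟨i⟩⟩ := exists_defect_duality hn hP hI
  -- Passing to the opposite category swaps projective and injective objects, and an equivalence
  -- preserves and reflects them.
  have hproj : ∀ X : FPMod (IdealQuotient T.proj),
      isProjective _ X ↔ isInjective _ (Φ.functor.obj (op X)) := fun X =>
    Injective.projective_iff_injective_op.trans (Φ.map_injective_iff (op X)).symm
  have hinj : ∀ X : FPMod (IdealQuotient T.proj),
      isInjective _ X ↔ isProjective _ (Φ.functor.obj (op X)) := fun X =>
    Injective.injective_iff_projective_op.trans (Φ.map_projective_iff (op X)).symm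
  obtain ⟨Φ₁, ⟨i₁⟩⟩ := exists_restricted_duality Φ (isProjective _) (isInjective _) hproj
  obtain ⟨Φ₂, ⟨i₂⟩⟩ := exists_restricted_duality Φ (isInjective _) (isProjective _) hinj
  obtain ⟨y⟩ := nonempty_yoneda_iso_ext hn hP hI i
  have hfp := isFinPres_extContra hn hP hI
  obtain ⟨z⟩ := nonempty_ext_iso_yoneda hn hP hI hfp i
  refine ⟨Φ, hΦ, ⟨_, _, inferInstance, inferInstance, nonempty_iso_contraDefect hn hP,
    nonempty_iso_covDefect hn hI, ⟨i⟩⟩, fun _ => ⟨⟨Φ₁, ⟨i₁⟩, ?_⟩, ⟨Φ₂, ⟨i₂⟩, ?_⟩⟩⟩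
  · let Y : C ⥤ ProjMod (IdealQuotient T.proj) :=
      (isProjective _).lift (toQuotient T.proj ⋙ fpYoneda _) fun A =>
        projective_fpYoneda ((toQuotient T.proj).obj A)
    exact ⟨Y, ⟨Iso.refl _⟩, ⟨Functor.isoWhiskerLeft Y.op
      (Functor.isoWhiskerRight i₁ (restrictLeft T.inj)) ≪≫ y⟩⟩
  · let J : C ⥤ InjMod (IdealQuotient T.proj) :=
      -- `𝔼(-,A)` is injective because `Φ` sends it to the representable `(C/[I])(A,-)`, which is
      -- projective.
      (isInjective _).lift (fpExtContra hfp) fun A => (hinj _).2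
        ((isProjective _).prop_of_iso (z.symm.app (op A))
          (projective_fpYoneda (op ((toQuotient T.inj).obj A))))
    exact ⟨J, ⟨Iso.refl _⟩, ⟨Functor.isoWhiskerLeft J.op
      (Functor.isoWhiskerRight i₂ (isFinPres (IdealQuotient T.inj)ᵒᵖ).ι) ≪≫
      Functor.isoWhiskerRight z (isFinPres (IdealQuotient T.inj)ᵒᵖ).ι⟩⟩
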